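/- **Theorem 4.2.** Let $H$ be a real Hilbert space, $B:H\to H$, $f\in H$, and suppose that $F(u):=B(u)-f$ is monotone, i.e. $\langle F(u)-F(v),u-v\rangle\ge 0$ for all $u,v\in H$. Let $y$ be a zero of $F$ of minimal norm: $F(y)=0$ and $\|y\|\le\|z\|$ whenever $F(z)=0$. Let $u_0\in H$ be arbitrary, $r:=\|y\|+\|u_0\|$, $R:=3r$, $B(u_0,R):=\{u:\|u-u_0\|\le R\}$. Suppose that $F$ is twice Fréchet differentiable at every point of $B(u_0,R)$, with $\|F'(u)\|\le M_1$ and $\|F''(u)\|\le M_2$ for all $u\in B(u_0,R)$. Let $\varepsilon(t)=c_1(c_0+t)^{-b}$, where $0<b<1$, $c_0>2b$ (equivalently $|\dot\varepsilon(t)|/\varepsilon(t)<\tfrac12$ for all $t\ge0$), $c_1>0$ and, if $r>0$, $\varepsilon(0)=c_1c_0^{-b}=4M_2r$. Then: 1. $y$ is the unique minimal-norm zero of $F$. 2. The problem $$\dot u=-(F'(u)+\varepsilon(t)I)^{-1}\,[F(u)+\varepsilon(t)u],\qquad u(0)=u_0,$$ has a solution on $[0,\infty)$. Every such solution satisfies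 $u(t)\in B(u_0,R)$ for all $t\ge0$ and $\lim_{t\to\infty}u(t)=y$ (so $F(u(\infty))=0$). 3. There are stopping times $t_\delta\ge0$ $(\delta>0)$, depending on $\delta$ but not on the particular noisy datum, with the following property. For every $\eta>0$ there is $\delta_0>0$ such that for all $0<\delta<\delta_0$ and all $f_\delta\in H$ with $\|f_\delta-f\|\le\delta$, the problem $$\dot u_\delta=-(F'(u_\delta)+\varepsilon(t)I)^{-1}\,[B(u_\delta)-f_\delta+\varepsilon(t)u_\delta],\qquad u_\delta(0)=u_0,$$ has a solution on $[0,t_\delta]$, and every such solution satisfies $\|u_\delta(t_\delta)-y\|<\eta$. That is, $\lim_{\delta\to0}\|u_\delta(t_\delta)-y\|=0$, uniformly over the admissible noisy data. Here a solution is a function that is differentiable on the indicated time interval (one-sided at endpoints), satisfies the equation at every point of that interval, and along which $F$ is Fréchet differentiable and $F'+\varepsilon(t)I$ is boundedly invertible. -/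

import Mathlib

open Set Filter Topology

noncomputable section

namespace NewtonFlow

variable {H : Type*} [NormedAddCommGroup H] [InnerProductSpace ℝ H]

/-- `F` is a monotone operator on the real Hilbert space `H`. -/
def MonotoneOperator (F : H → H) : Prop :=
  ∀ u v : H, 0 ≤ inner ℝ (F u - F v) (u - v)

/-- `F` has first and second Fréchet derivatives at every point of the closed ball
`{u | ‖u - u₀‖ ≤ R}`, bounded there by `M₁` and `M₂` respectively. -/
def BoundedDerivatives (F : H → H) (u₀ : H) (R M₁ M₂ : ℝ) : Prop :=
  ∀ u ∈ Metric.closedBall u₀ R,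
    DifferentiableAt ℝ F u ∧ DifferentiableAt ℝ (fderiv ℝ F) u ∧
      ‖fderiv ℝ F u‖ ≤ M₁ ∧ ‖fderiv ℝ (fderiv ℝ F) u‖ ≤ M₂

/-- `y` is a zero of `F` of minimal norm. -/
def IsMinimalNormZero (F : H → H) (y : H) : Prop :=
  F y = 0 ∧ ∀ z : H, F z = 0 → ‖y‖ ≤ ‖z‖

/-- The regularization function `ε(t) = c₁ (c₀ + t)^(-b)`. -/
def regFun (b c₀ c₁ : ℝ) (t : ℝ) : ℝ := c₁ * (c₀ + t) ^ (-b)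

/-- The regularized derivative `F'(u) + e I`. -/
def regDeriv (F : H → H) (e : ℝ) (u : H) : H →L[ℝ] H :=
  fderiv ℝ F u + e • ContinuousLinearMap.id ℝ H

/-- The right-hand side `Φ(t, u) = -(F'(u) + ε(t) I)⁻¹ [F(u) + ε(t) u]`. -/
def field (F : H → H) (ε : ℝ → ℝ) (t : ℝ) (u : H) : H :=
  -((regDeriv F (ε t) u).inverse (F u + ε t • u))

/-- `u` solves `u' = Φ(t, u)`, `u(0) = u₀` on the time interval `I` (which is `[0, ∞)` or `[0, T]`).
It is part of the definition that `Φ(t, u(t))` is meaningful: `F` is Fréchet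
differentiable at `u(t)` and `F'(u(t)) + ε(t) I` has a bounded inverse. -/
def IsSolutionOn (F : H → H) (ε : ℝ → ℝ) (u₀ : H) (I : Set ℝ) (u : ℝ → H) : Prop :=
  u 0 = u₀ ∧ ∀ t ∈ I,
    DifferentiableAt ℝ F (u t) ∧ (regDeriv F (ε t) (u t)).IsInvertible ∧
      HasDerivWithinAt u (field F ε t (u t)) I t

end NewtonFlow

end

/-! For `ε > 0` let `w(ε)` be the zero of `F + ε I`. Monotonicity shows that `‖w(ε)‖` increases as
`ε` decreases, is bounded by `‖y‖`, and satisfies `‖w - w'‖² ≤ ‖w'‖² - ‖w‖²`. Hence `w(ε)` converges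
strongly as `ε → 0`, and the limit is the minimal-norm zero `y` (`tendsto_regularizedZero`). It
remains to show that the flow follows this path.

Noise adds the constant `d = f - fδ` to `F` and leaves `F'` unchanged. Along a solution the residual
`ψ = F(u) + d + εu` satisfies `ψ' = -ψ + ε'u`. If `u` is bounded, then `ψ = O(ε/t)`, because `|ε'|/ε
= b/(c₀ + t)`. Strong monotonicity of `F + εI` turns this into `‖u - w(ε)‖ ≤ K/(c₀ + 4 + t) + ‖d‖/ε`
(`exists_norm_sub_path_le`). This gives convergence for exact data, and for noisy data at any time
where `δ/ε → 0`.

Boundedness comes from the barrier `‖u - w(ε(t))‖ ≤ ε(t)/(2M₂)` (`norm_sub_path_le`). At a contact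
point the Newton direction shortens the distance `k` at rate at least `3k/4`, up to noise, the
quadratic Taylor error costing only `k/4`. The path moves and the barrier sinks more slowly than
that, thanks to `b < 1`, `2b < c₀` and `ε(0) = 4M₂r`. This argument uses the equation only inside
the ball, so it also applies to the flow with its argument projected onto the ball. The projected
flow is solved by Picard–Lindelöf, never leaves the ball, and so solves the original problem.

The case `r = 0`, where `ε(0)` and `M₂` are unrelated, is separate: there `u₀ = y = 0`. -/

namespace NewtonFlow

/-! ### A one-sided barrier argument. -/

section Fencing

/-- A fencing principle: a continuous function that starts below a barrier stays below it if at
every contact point it has a differentiable majorant, touching it there, that grows more slowly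
than the barrier. -/
theorem le_barrier_of_majorant {f β β' : ℝ → ℝ} {a b : ℝ} (hf : ContinuousOn f (Icc a b))
    (hβ : ContinuousOn β (Icc a b)) (ha : f a ≤ β a)
    (hβ' : ∀ x ∈ Ico a b, HasDerivWithinAt β (β' x) (Ici x) x)
    (hcontact : ∀ x ∈ Ico a b, f x = β x → ∃ (m : ℝ → ℝ) (m' : ℝ), m x = f x ∧
      (∀ z ∈ Ioc x b, f z ≤ m z) ∧ HasDerivWithinAt m m' (Icc x b) x ∧ m' < β' x) :
    ∀ x ∈ Icc a b, f x ≤ β x := by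
  change Icc a b ⊆ {x | f x ≤ β x}
  have hclosed : IsClosed ({x | f x ≤ β x} ∩ Icc a b) := by
    rw [inter_comm]
    exact (hf.prodMk hβ).preimage_isClosed_of_isClosed isClosed_Icc
      OrderClosedTopology.isClosed_le'
  apply hclosed.Icc_subset_of_forall_exists_gt ha
  rintro x ⟨hxβ : f x ≤ β x, hx⟩ y hy
  rcases hxβ.lt_or_eq with hlt | heq
  · refine nonempty_of_mem (inter_mem ?_ (Ioc_mem_nhdsGT hy))
    have h : ∀ᶠ z in 𝓝[Icc a b] x, f z < β z :=
      (hf.prodMk hβ) x (Ico_subset_Icc_self hx)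
        (IsOpen.mem_nhds (isOpen_lt continuous_fst continuous_snd) hlt)
    have h' : ∀ᶠ z in 𝓝[>] x, f z < β z := nhdsWithin_le_of_mem (Icc_mem_nhdsGT_of_mem hx) h
    exact h'.mono fun z => le_of_lt
  · obtain ⟨m, m', hmx, hfm, hm, hlt⟩ := hcontact x hx heq
    have hm₁ : HasDerivWithinAt m m' (Ioi x) x :=
      hm.mono_of_mem_nhdsWithin (Icc_mem_nhdsGT_of_mem ⟨le_rfl, hx.2⟩)
    have hd := hm₁.sub ((hβ' x hx).mono Ioi_subset_Ici_self)
    rw [hasDerivWithinAt_iff_tendsto_slope' (by simp)] at hd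
    -- `m - β` vanishes at `x` and has negative right derivative, so its difference quotients are
    -- negative just after `x`.
    have hev := hd.eventually (gt_mem_nhds (sub_neg.2 hlt))
    refine nonempty_of_mem (inter_mem ?_ (Ioc_mem_nhdsGT hy))
    filter_upwards [hev, self_mem_nhdsWithin, Ioc_mem_nhdsGT hx.2] with z hz hxz hzb
    have hpos : 0 < z - x := sub_pos.2 hxz
    rw [slope_def_field, div_lt_iff₀ hpos] at hz
    simp only [Pi.sub_apply] at hz
    have := hfm z hzb
    show f z ≤ β z
    linarith

end Fencing

/-! ### Monotone operators and the inverses of their regularized derivatives. -/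

section Operators

variable {H : Type*} [NormedAddCommGroup H] [InnerProductSpace ℝ H]

theorem MonotoneOperator.inner_fderiv_nonneg {F : H → H} (hF : MonotoneOperator F) {u : H}
    (hu : DifferentiableAt ℝ F u) (v : H) : 0 ≤ inner ℝ (fderiv ℝ F u v) v := by
  have h₁ : HasDerivAt (fun s : ℝ => F (u + s • v)) (fderiv ℝ F u v) 0 := by
    have h₂ : HasDerivAt (fun s : ℝ => u + s • v) v 0 := by
      simpa using ((hasDerivAt_id (0 : ℝ)).smul_const v).const_add u
    have h₃ : HasFDerivAt F (fderiv ℝ F u) (u + (0 : ℝ) • v) := by simpa using hu.hasFDerivAt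
    exact h₃.comp_hasDerivAt (0 : ℝ) h₂
  have h₂ : HasDerivAt (fun s : ℝ => inner ℝ (F (u + s • v)) v) (inner ℝ (fderiv ℝ F u v) v) 0 := by
    simpa using h₁.inner ℝ (hasDerivAt_const (0 : ℝ) v)
  rw [hasDerivAt_iff_tendsto_slope] at h₂
  refine ge_of_tendsto h₂ ?_
  filter_upwards [self_mem_nhdsWithin] with s hs
  have hs : s ≠ 0 := hs
  have h := hF (u + s • v) u
  rw [add_sub_cancel_left, inner_smul_right] at h
  rw [slope_def_field, sub_zero, ← inner_sub_left, zero_smul, add_zero]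
  have : s * inner ℝ (F (u + s • v) - F u) v / s ^ 2 = inner ℝ (F (u + s • v) - F u) v / s := by
    field_simp
  rw [← this]
  positivity

/-- Minty's trick: a point of continuity of `F` satisfying the dual variational inequality is a
zero of `F`. -/
theorem eq_zero_of_forall_inner_nonneg {F : H → H} {m : H} (hc : ContinuousAt F m)
    (h : ∀ v, 0 ≤ inner ℝ (F v) (v - m)) : F m = 0 := by
  have h₁ : Tendsto (fun s : ℝ => inner ℝ (F (m - s • F m)) (F m)) (𝓝[>] 0)
      (𝓝 (inner ℝ (F m) (F m))) := by
    have h₂ : ContinuousAt (fun s : ℝ => F (m - s • F m)) 0 := by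
      apply ContinuousAt.comp
      · simpa using hc
      · fun_prop
    have h₃ : ContinuousAt (fun s : ℝ => inner ℝ (F (m - s • F m)) (F m)) 0 :=
      ContinuousAt.inner (𝕜 := ℝ) h₂ continuousAt_const
    simpa using h₃.tendsto.mono_left nhdsWithin_le_nhds
  have h₂ : inner ℝ (F m) (F m) ≤ 0 := by
    refine le_of_tendsto h₁ ?_
    filter_upwards [self_mem_nhdsWithin] with s hs
    have hs : 0 < s := hs
    have := h (m - s • F m)
    rw [sub_sub_cancel_left, inner_neg_right, inner_smul_right] at this
    nlinarith
  rw [real_inner_self_eq_norm_sq] at h₂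
  have := norm_nonneg (F m)
  exact norm_eq_zero.1 (by nlinarith)

/-- Zeros of a monotone map satisfy the dual inequality, which is affine in the point and so passes
to the midpoint; Minty's trick makes the midpoint a zero. By the parallelogram law it would be
strictly shorter if the two points differed. -/
theorem IsMinimalNormZero.unique {F : H → H} (hF : MonotoneOperator F) {y z : H}
    (hy : IsMinimalNormZero F y) (hz : IsMinimalNormZero F z)
    (hc : ContinuousAt F (midpoint ℝ z y)) : z = y := by
  have hnorm : ‖z‖ = ‖y‖ := le_antisymm (hz.2 y hy.1) (hy.2 z hz.1)
  have hmid : midpoint ℝ z y = (1 / 2 : ℝ) • (z + y) := by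
    rw [midpoint_eq_smul_add]; norm_num
  have hzero : F (midpoint ℝ z y) = 0 := by
    refine eq_zero_of_forall_inner_nonneg hc fun v => ?_
    have h₁ := hF v y
    have h₂ := hF v z
    rw [hy.1, sub_zero] at h₁
    rw [hz.1, sub_zero] at h₂
    have : v - midpoint ℝ z y = (1 / 2 : ℝ) • ((v - z) + (v - y)) := by
      rw [hmid]; module
    rw [this, inner_smul_right, inner_add_right]
    linarith
  have h₁ := hy.2 _ hzero
  rw [hmid, norm_smul, Real.norm_of_nonneg (by norm_num)] at h₁
  have h₂ := parallelogram_law_with_norm ℝ z y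
  have h₃ : ‖z - y‖ = 0 := by
    have := norm_nonneg (z - y)
    have := norm_nonneg y
    rw [hnorm] at h₂
    nlinarith
  exact sub_eq_zero.1 (norm_eq_zero.1 h₃)

variable {F : H → H} {u : H} {e : ℝ}

theorem MonotoneOperator.le_inner_regDeriv (hF : MonotoneOperator F) (hu : DifferentiableAt ℝ F u)
    (v : H) : e * ‖v‖ ^ 2 ≤ inner ℝ (regDeriv F e u v) v := by
  have := hF.inner_fderiv_nonneg hu v
  simp only [regDeriv, add_apply, smul_apply,
    ContinuousLinearMap.id_apply, inner_add_left, inner_smul_left, real_inner_self_eq_norm_sq,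
    conj_trivial]
  linarith

theorem MonotoneOperator.mul_norm_le_norm_regDeriv (hF : MonotoneOperator F)
    (hu : DifferentiableAt ℝ F u) (v : H) : e * ‖v‖ ≤ ‖regDeriv F e u v‖ := by
  rcases (norm_nonneg v).eq_or_lt with h | h
  · rw [← h]; simp
  · have h₁ := hF.le_inner_regDeriv (e := e) hu v
    have h₂ := real_inner_le_norm (regDeriv F e u v) v
    nlinarith

/-- Lax–Milgram: `F'(u)` is nonnegative, so adding `e I` makes it coercive with constant `e`. -/
theorem MonotoneOperator.isInvertible_regDeriv [CompleteSpace H] (hF : MonotoneOperator F)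
    (hu : DifferentiableAt ℝ F u) (he : 0 < e) : (regDeriv F e u).IsInvertible := by
  have h : IsUnit (regDeriv F e u) := by
    refine ContinuousLinearMap.isUnit_of_forall_le_norm_inner_map (𝕜 := ℝ) _ (c := ⟨e, he.le⟩) he
      fun x => ?_
    have := hF.le_inner_regDeriv (e := e) hu x
    rw [mul_comm]
    exact this.trans (le_abs_self _)
  obtain ⟨U, hU⟩ := h
  exact ⟨ContinuousLinearEquiv.unitsEquiv ℝ H U, by rw [← hU]; rfl⟩

theorem MonotoneOperator.norm_inverse_regDeriv_le [CompleteSpace H] (hF : MonotoneOperator F)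
    (hu : DifferentiableAt ℝ F u) (he : 0 < e) (x : H) :
    ‖(regDeriv F e u).inverse x‖ ≤ ‖x‖ / e := by
  rw [le_div_iff₀ he, mul_comm]
  simpa [(hF.isInvertible_regDeriv hu he).self_apply_inverse] using
    hF.mul_norm_le_norm_regDeriv (e := e) hu ((regDeriv F e u).inverse x)

theorem MonotoneOperator.norm_inverse_regDeriv_sub_le [CompleteSpace H] (hF : MonotoneOperator F)
    {v : H} {e' : ℝ} (hu : DifferentiableAt ℝ F u) (hv : DifferentiableAt ℝ F v)
    (he : 0 < e) (he' : 0 < e') (x x' : H) :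
    ‖(regDeriv F e u).inverse x - (regDeriv F e' v).inverse x'‖ ≤
      (‖x - x'‖ + ‖regDeriv F e u - regDeriv F e' v‖ * (‖x'‖ / e')) / e := by
  have h₁ := hF.isInvertible_regDeriv hu he
  have h₂ := hF.isInvertible_regDeriv hv he'
  -- The resolvent identity `A⁻¹x - B⁻¹x' = A⁻¹(x - x' - (A - B)B⁻¹x')`.
  have h : (regDeriv F e u).inverse x - (regDeriv F e' v).inverse x' =
      (regDeriv F e u).inverse (x - x' -
        (regDeriv F e u - regDeriv F e' v) ((regDeriv F e' v).inverse x')) := by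
    rw [sub_apply, h₂.self_apply_inverse, map_sub, map_sub, map_sub,
      h₁.inverse_apply_self]
    abel
  rw [h]
  refine (hF.norm_inverse_regDeriv_le hu he _).trans ?_
  gcongr
  refine (norm_sub_le _ _).trans ?_
  gcongr
  refine (ContinuousLinearMap.le_opNorm _ _).trans ?_
  gcongr
  exact hF.norm_inverse_regDeriv_le hv he' x'

end Operators

/-! ### Mean value and Taylor estimates on the ball. -/

section Ball

variable {H : Type*} [NormedAddCommGroup H] [InnerProductSpace ℝ H]
  {F : H → H} {u₀ : H} {R M₁ M₂ : ℝ}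

theorem BoundedDerivatives.norm_sub_le (h : BoundedDerivatives F u₀ R M₁ M₂) {u v : H}
    (hu : u ∈ Metric.closedBall u₀ R) (hv : v ∈ Metric.closedBall u₀ R) :
    ‖F u - F v‖ ≤ M₁ * ‖u - v‖ :=
  (convex_closedBall u₀ R).norm_image_sub_le_of_norm_fderiv_le (𝕜 := ℝ)
    (fun x hx => (h x hx).1) (fun x hx => (h x hx).2.2.1) hv hu

theorem BoundedDerivatives.norm_fderiv_sub_le (h : BoundedDerivatives F u₀ R M₁ M₂) {u v : H}
    (hu : u ∈ Metric.closedBall u₀ R) (hv : v ∈ Metric.closedBall u₀ R) :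
    ‖fderiv ℝ F u - fderiv ℝ F v‖ ≤ M₂ * ‖u - v‖ :=
  (convex_closedBall u₀ R).norm_image_sub_le_of_norm_fderiv_le (𝕜 := ℝ)
    (fun x hx => (h x hx).2.1) (fun x hx => (h x hx).2.2.2) hv hu

/-- Second-order Taylor estimate on the ball. -/
theorem BoundedDerivatives.norm_taylor_le (h : BoundedDerivatives F u₀ R M₁ M₂) {u v : H}
    (hu : u ∈ Metric.closedBall u₀ R) (hv : v ∈ Metric.closedBall u₀ R) :
    ‖F v - F u - fderiv ℝ F u (v - u)‖ ≤ M₂ / 2 * ‖v - u‖ ^ 2 := by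
  have hmem : ∀ s ∈ Icc (0 : ℝ) 1, u + s • (v - u) ∈ Metric.closedBall u₀ R := fun s hs =>
    (convex_closedBall u₀ R).add_smul_sub_mem hu hv hs
  have hd : ∀ s ∈ Icc (0 : ℝ) 1, HasDerivAt
      (fun s : ℝ => F (u + s • (v - u)) - F u - s • fderiv ℝ F u (v - u))
      (fderiv ℝ F (u + s • (v - u)) (v - u) - fderiv ℝ F u (v - u)) s := by
    intro s hs
    have h₁ : HasDerivAt (fun s : ℝ => u + s • (v - u)) (v - u) s := by
      simpa using ((hasDerivAt_id s).smul_const (v - u)).const_add u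
    have h₂ := (h _ (hmem s hs)).1.hasFDerivAt.comp_hasDerivAt s h₁
    have h₃ := (hasDerivAt_id s).smul_const (fderiv ℝ F u (v - u))
    rw [one_smul] at h₃
    exact (h₂.sub_const (F u)).sub h₃
  -- `F''` is bounded but not assumed continuous, so a derivative comparison along the segment
  -- replaces the integral remainder.
  have key := image_norm_le_of_norm_deriv_right_le_deriv_boundary (a := (0 : ℝ)) (b := 1)
    (f := fun s : ℝ => F (u + s • (v - u)) - F u - s • fderiv ℝ F u (v - u))
    (B := fun s => M₂ / 2 * ‖v - u‖ ^ 2 * s ^ 2) (B' := fun s => M₂ * ‖v - u‖ ^ 2 * s)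
    (fun s hs => (hd s hs).continuousAt.continuousWithinAt)
    (fun s hs => (hd s (Ico_subset_Icc_self hs)).hasDerivWithinAt) (by simp)
    (fun s => by
      have := (hasDerivAt_pow 2 s).const_mul (M₂ / 2 * ‖v - u‖ ^ 2)
      exact this.congr_deriv (by push_cast; ring))
    (fun s hs => by
      rw [← sub_apply]
      refine (ContinuousLinearMap.le_opNorm _ _).trans ?_
      have := h.norm_fderiv_sub_le (hmem s (Ico_subset_Icc_self hs)) hu
      rw [add_sub_cancel_left, norm_smul, Real.norm_of_nonneg hs.1] at this
      nlinarith [norm_nonneg (v - u)])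
  simpa using key (right_mem_Icc.2 zero_le_one)

end Ball

/-! ### Regularized zeros: existence, monotonicity, convergence. -/

section RegularizedZeros

theorem mem_closedBall_of_norm_le {E : Type*} [NormedAddCommGroup E] {y u₀ v : E} {r : ℝ} (hr : r = ‖y‖ + ‖u₀‖) (hv : ‖v‖ ≤ ‖y‖) :
    v ∈ Metric.closedBall u₀ r := by
  rw [mem_closedBall_iff_norm]
  have := norm_sub_le v u₀
  linarith

theorem closedBall_subset_three {E : Type*} [NormedAddCommGroup E] {y u₀ : E} {r : ℝ} (hr : r = ‖y‖ + ‖u₀‖) :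
    Metric.closedBall u₀ r ⊆ Metric.closedBall u₀ (3 * r) := by
  have := norm_nonneg y
  have := norm_nonneg u₀
  exact Metric.closedBall_subset_closedBall (by linarith)

variable {H : Type*} [NormedAddCommGroup H] [InnerProductSpace ℝ H]
  {F : H → H} {w w' : H} {e e' : ℝ}

theorem MonotoneOperator.inner_smul_sub_smul_nonpos (hF : MonotoneOperator F)
    (hw : F w + e • w = 0) (hw' : F w' + e' • w' = 0) :
    inner ℝ (e • w - e' • w') (w - w') ≤ 0 := by
  have h := hF w w'
  rw [eq_neg_of_add_eq_zero_left hw, eq_neg_of_add_eq_zero_left hw',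
    show -(e • w) - -(e' • w') = -(e • w - e' • w') by abel, inner_neg_left] at h
  linarith

/-- Lipschitz dependence of the regularized zeros on the regularization parameter. -/
theorem MonotoneOperator.norm_regularizedZero_sub_le (hF : MonotoneOperator F) (he : 0 < e)
    (hw : F w + e • w = 0) (hw' : F w' + e' • w' = 0) :
    ‖w - w'‖ ≤ |e - e'| * ‖w'‖ / e := by
  have h := hF.inner_smul_sub_smul_nonpos hw hw'
  rw [show e • w - e' • w' = e • (w - w') + (e - e') • w' by module, inner_add_left,
    real_inner_smul_left, real_inner_smul_left, real_inner_self_eq_norm_sq] at h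
  have h₁ : -((e - e') * inner ℝ w' (w - w')) ≤ |e - e'| * (‖w'‖ * ‖w - w'‖) := by
    refine (neg_le_abs _).trans ?_
    rw [abs_mul]
    gcongr
    exact abs_real_inner_le_norm _ _
  rw [le_div_iff₀ he]
  rcases (norm_nonneg (w - w')).eq_or_lt with h₂ | h₂
  · rw [← h₂, zero_mul]; positivity
  · nlinarith

theorem MonotoneOperator.norm_sq_le_inner_regularizedZero (hF : MonotoneOperator F)
    (hlt : e' < e) (he' : 0 ≤ e') (hw : F w + e • w = 0) (hw' : F w' + e' • w' = 0) :
    ‖w‖ ^ 2 ≤ inner ℝ w w' := by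
  have h := hF.inner_smul_sub_smul_nonpos hw hw'
  rw [show e • w - e' • w' = e' • (w - w') + (e - e') • w by module, inner_add_left,
    real_inner_smul_left, real_inner_smul_left, real_inner_self_eq_norm_sq, inner_sub_right,
    real_inner_self_eq_norm_sq] at h
  have : 0 ≤ e' * ‖w - w'‖ ^ 2 := by positivity
  nlinarith [sub_pos.2 hlt]

theorem MonotoneOperator.norm_sub_sq_le_regularizedZero (hF : MonotoneOperator F)
    (hlt : e' < e) (he' : 0 ≤ e') (hw : F w + e • w = 0) (hw' : F w' + e' • w' = 0) :
    ‖w - w'‖ ^ 2 ≤ ‖w'‖ ^ 2 - ‖w‖ ^ 2 := by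
  have := hF.norm_sq_le_inner_regularizedZero hlt he' hw hw'
  rw [norm_sub_sq_real]
  linarith

theorem MonotoneOperator.norm_regularizedZero_le (hF : MonotoneOperator F)
    (hlt : e' < e) (he' : 0 ≤ e') (hw : F w + e • w = 0) (hw' : F w' + e' • w' = 0) :
    ‖w‖ ≤ ‖w'‖ := by
  have := hF.norm_sub_sq_le_regularizedZero hlt he' hw hw'
  exact (abs_le_of_sq_le_sq' (by nlinarith [sq_nonneg ‖w - w'‖]) (norm_nonneg _)).2

theorem MonotoneOperator.norm_regularizedZero_le_norm_zero (hF : MonotoneOperator F) (he : 0 < e)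
    {y : H} (hw : F w + e • w = 0) (hy : F y = 0) : ‖w‖ ≤ ‖y‖ :=
  hF.norm_regularizedZero_le he le_rfl hw (by simpa using hy)

variable {u₀ y : H} {r M₁ M₂ : ℝ}

theorem BoundedDerivatives.continuousAt_of_norm_le (h : BoundedDerivatives F u₀ (3 * r) M₁ M₂)
    (hr : r = ‖y‖ + ‖u₀‖) {v : H} (hv : ‖v‖ ≤ ‖y‖) : ContinuousAt F v :=
  (h v (closedBall_subset_three hr (mem_closedBall_of_norm_le hr hv))).1.continuousAt

theorem BoundedDerivatives.minimalNormZero_unique (h : BoundedDerivatives F u₀ (3 * r) M₁ M₂)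
    (hr : r = ‖y‖ + ‖u₀‖) (hF : MonotoneOperator F) (hy : IsMinimalNormZero F y) {z : H}
    (hz : IsMinimalNormZero F z) : z = y := by
  refine hy.unique hF hz (h.continuousAt_of_norm_le hr ?_)
  have h₁ := hz.2 y hy.1
  have h₂ := norm_add_le z y
  rw [midpoint_eq_smul_add, norm_smul]
  norm_num
  linarith

/-- Solvability of the regularized equation, by iterating `v ↦ v - s (F v + e v)` on the ball of
radius `2‖y‖` about `y`. -/
theorem BoundedDerivatives.exists_regularizedZero [CompleteSpace H]
    (h : BoundedDerivatives F u₀ (3 * r) M₁ M₂) (hr : r = ‖y‖ + ‖u₀‖) (hF : MonotoneOperator F)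
    (hy : F y = 0) (he : 0 < e) : ∃ w, F w + e • w = 0 := by
  have hy₀ := norm_nonneg y
  have hu₀ := norm_nonneg u₀
  have hM₁ : 0 ≤ M₁ :=
    (norm_nonneg _).trans (h u₀ (Metric.mem_closedBall_self (by linarith))).2.2.1
  have hsub : Metric.closedBall y (2 * ‖y‖) ⊆ Metric.closedBall u₀ (3 * r) := by
    refine Metric.closedBall_subset_closedBall' ?_
    rw [dist_eq_norm]
    have := _root_.norm_sub_le y u₀
    linarith
  set L := M₁ + e with hL
  have hLpos : 0 < L := by positivity
  -- This step size minimizes `1 - 2se + s²L²`; the value `1 - se` is at most `(1 - se/2)²`.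
  set s := e / L ^ 2 with hs
  have hspos : 0 < s := by positivity
  have hsL : s * L ^ 2 = e := by rw [hs]; field_simp
  have hse : s * e ≤ 1 := by
    rw [hs, div_mul_eq_mul_div, div_le_one (by positivity)]
    nlinarith
  set T : H → H := fun v => v - s • (F v + e • v) with hT
  have hlip : ∀ v ∈ Metric.closedBall y (2 * ‖y‖), ∀ v' ∈ Metric.closedBall y (2 * ‖y‖),
      ‖T v - T v'‖ ≤ (1 - s * e / 2) * ‖v - v'‖ := by
    intro v hv v' hv'
    set g := F v - F v' + e • (v - v') with hg
    have h₁ : T v - T v' = (v - v') - s • g := by simp only [hT, hg]; module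
    have h₂ : ‖g‖ ≤ L * ‖v - v'‖ := by
      refine (norm_add_le _ _).trans ?_
      rw [norm_smul, Real.norm_of_nonneg he.le, hL, add_mul]
      gcongr
      exact h.norm_sub_le (hsub hv) (hsub hv')
    have h₃ : e * ‖v - v'‖ ^ 2 ≤ inner ℝ (v - v') g := by
      rw [hg, real_inner_comm, inner_add_left, real_inner_smul_left, real_inner_self_eq_norm_sq]
      linarith [hF v v']
    refine abs_le_of_sq_le_sq' ?_ (by nlinarith [norm_nonneg (v - v')]) |>.2
    rw [h₁, norm_sub_sq_real, real_inner_smul_right, norm_smul, Real.norm_of_nonneg hspos.le]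
    have h₄ : (s * ‖g‖) ^ 2 ≤ s * e * ‖v - v'‖ ^ 2 := by
      calc (s * ‖g‖) ^ 2 ≤ (s * (L * ‖v - v'‖)) ^ 2 := by gcongr
        _ = s * (s * L ^ 2) * ‖v - v'‖ ^ 2 := by ring
        _ = _ := by rw [hsL]
    have h₅ : s * (e * ‖v - v'‖ ^ 2) ≤ s * inner ℝ (v - v') g := by gcongr
    nlinarith [sq_nonneg (s * e * ‖v - v'‖)]
  have hmaps : MapsTo T (Metric.closedBall y (2 * ‖y‖)) (Metric.closedBall y (2 * ‖y‖)) := by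
    intro v hv
    have h₁ := hlip v hv y (Metric.mem_closedBall_self (by positivity))
    rw [mem_closedBall_iff_norm] at hv ⊢
    -- Since `T y - y = -(se) y`, a ball of radius `ρ` about `y` is mapped to itself once `(1 -
    -- se/2)ρ + se‖y‖ ≤ ρ`, which holds with equality for `ρ = 2‖y‖`.
    have h₂ : T v - y = (T v - T y) - (s * e) • y := by simp only [hT, hy]; module
    rw [h₂]
    refine (_root_.norm_sub_le _ _).trans ?_
    rw [norm_smul, Real.norm_of_nonneg (by positivity)]
    nlinarith [mul_pos hspos he]
  have hcontr : ContractingWith (Real.toNNReal (1 - s * e / 2)) (hmaps.restrict T _ _) := by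
    refine ⟨?_, LipschitzWith.of_dist_le_mul fun v v' => ?_⟩
    · rw [Real.toNNReal_lt_one]
      nlinarith [mul_pos hspos he]
    · rw [Real.coe_toNNReal _ (by linarith), Subtype.dist_eq, Subtype.dist_eq, dist_eq_norm,
        dist_eq_norm]
      exact hlip v v.2 v' v'.2
  obtain ⟨w, -, hw, -⟩ := hcontr.exists_fixedPoint' (x := y)
    Metric.isClosed_closedBall.isComplete hmaps (Metric.mem_closedBall_self (by positivity))
    (edist_ne_top _ _)
  refine ⟨w, ?_⟩
  have h₁ : w - s • (F w + e • w) = w := hw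
  rw [sub_eq_self, smul_eq_zero] at h₁
  exact h₁.resolve_left hspos.ne'

/-- The regularized zeros converge strongly to the minimal-norm zero. -/
theorem BoundedDerivatives.tendsto_regularizedZero [CompleteSpace H]
    (h : BoundedDerivatives F u₀ (3 * r) M₁ M₂) (hr : r = ‖y‖ + ‖u₀‖) (hF : MonotoneOperator F)
    (hy : IsMinimalNormZero F y) {w : ℝ → H} (hw : ∀ e, 0 < e → F (w e) + e • w e = 0) :
    Tendsto w (𝓝[>] 0) (𝓝 y) := by
  have hle : ∀ e, 0 < e → ‖w e‖ ≤ ‖y‖ := fun e he =>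
    hF.norm_regularizedZero_le_norm_zero he (hw e he) hy.1
  have hpos : ∀ n : ℕ, (0 : ℝ) < 1 / ((n : ℝ) + 1) := fun n => by positivity
  set v : ℕ → H := fun n => w (1 / ((n : ℝ) + 1)) with hv
  have hlt : ∀ m n : ℕ, m < n → (1 : ℝ) / ((n : ℝ) + 1) < 1 / ((m : ℝ) + 1) := fun m n hmn =>
    one_div_lt_one_div_of_lt (by positivity) (by simpa using hmn)
  have hdist : ∀ m n : ℕ, m ≤ n → ‖v m - v n‖ ^ 2 ≤ ‖v n‖ ^ 2 - ‖v m‖ ^ 2 := by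
    intro m n hmn
    rcases hmn.eq_or_lt with rfl | hmn
    · simp
    · exact hF.norm_sub_sq_le_regularizedZero (hlt m n hmn) (hpos n).le (hw _ (hpos m))
        (hw _ (hpos n))
  have hmono : Monotone fun n => ‖v n‖ ^ 2 := fun m n hmn => by
    have := hdist m n hmn
    have := sq_nonneg ‖v m - v n‖
    show ‖v m‖ ^ 2 ≤ ‖v n‖ ^ 2
    linarith
  have hbddAbove : BddAbove (range fun n => ‖v n‖ ^ 2) := by
    refine ⟨‖y‖ ^ 2, ?_⟩
    rintro _ ⟨n, rfl⟩
    have := hle _ (hpos n)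
    show ‖v n‖ ^ 2 ≤ ‖y‖ ^ 2
    gcongr
  have hcauchy : CauchySeq v := by
    have hc := (tendsto_atTop_ciSup hmono hbddAbove).cauchySeq
    rw [Metric.cauchySeq_iff'] at hc ⊢
    intro η hη
    obtain ⟨N, hN⟩ := hc (η ^ 2) (by positivity)
    refine ⟨N, fun n hn => ?_⟩
    have h₁ := (le_abs_self _).trans_lt (hN n hn)
    have h₂ := hdist N n hn
    rw [dist_comm, dist_eq_norm]
    exact lt_of_pow_lt_pow_left₀ 2 hη.le (h₂.trans_lt h₁)
  obtain ⟨z, hz⟩ := cauchySeq_tendsto_of_complete hcauchy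
  have hznorm : ‖z‖ ≤ ‖y‖ := le_of_tendsto hz.norm (Eventually.of_forall fun n => hle _ (hpos n))
  have hzero : F z = 0 := by
    have h₁ : Tendsto (fun n => F (v n)) atTop (𝓝 (F z)) :=
      (h.continuousAt_of_norm_le hr hznorm).tendsto.comp hz
    have h₂ : Tendsto (fun n => F (v n)) atTop (𝓝 (-((0 : ℝ) • z))) := by
      refine ((tendsto_one_div_add_atTop_nhds_zero_nat (𝕜 := ℝ)).smul hz).neg.congr fun n => ?_
      exact (eq_neg_of_add_eq_zero_left (hw _ (hpos n))).symm
    simpa using tendsto_nhds_unique h₁ h₂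
  have hzy : z = y := h.minimalNormZero_unique hr hF hy
    ⟨hzero, fun x hx => hznorm.trans (hy.2 x hx)⟩
  rw [hzy] at hz
  have hsq : Tendsto (fun n => ‖y‖ ^ 2 - ‖v n‖ ^ 2) atTop (𝓝 0) := by
    have h₁ := (hz.norm.pow 2).const_sub (‖y‖ ^ 2)
    rwa [sub_self (‖y‖ ^ 2)] at h₁
  rw [Metric.tendsto_nhds]
  intro η hη
  obtain ⟨n, hn⟩ := (hsq.eventually (gt_mem_nhds (show (0 : ℝ) < η ^ 2 by positivity))).exists
  filter_upwards [Ioo_mem_nhdsGT (hpos n)] with e he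
  -- With parameter `0`, `y` itself is a regularized zero; monotonicity of the norms then extends
  -- convergence along `1/(n+1)` to all `e → 0`.
  have h₁ := hF.norm_sub_sq_le_regularizedZero he.1 le_rfl (hw e he.1)
    (w' := y) (by simpa using hy.1)
  have h₂ := hF.norm_regularizedZero_le he.2 he.1.le (hw _ (hpos n)) (hw e he.1)
  have h₃ : ‖v n‖ ^ 2 ≤ ‖w e‖ ^ 2 := by
    show ‖w _‖ ^ 2 ≤ _
    gcongr
  rw [dist_eq_norm]
  exact lt_of_pow_lt_pow_left₀ 2 hη.le (by linarith)

end RegularizedZeros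

/-! ### The regularization function. -/

section RegFun

variable {b c₀ c₁ : ℝ}

theorem regFun_pos (hc₀ : 0 < c₀) (hc₁ : 0 < c₁) {t : ℝ} (ht : 0 ≤ t) : 0 < regFun b c₀ c₁ t :=
  mul_pos hc₁ (Real.rpow_pos_of_pos (by linarith) _)

theorem hasDerivAt_regFun (hc₀ : 0 < c₀) {t : ℝ} (ht : 0 ≤ t) :
    HasDerivAt (regFun b c₀ c₁) (-(b / (c₀ + t) * regFun b c₀ c₁ t)) t := by
  have hpos : 0 < c₀ + t := by linarith
  have h := (((hasDerivAt_id t).const_add c₀).rpow_const (p := -b) (Or.inl hpos.ne')).const_mul c₁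
  refine h.congr_deriv ?_
  simp only [id, regFun]
  rw [Real.rpow_sub_one hpos.ne']
  field_simp

theorem continuousOn_regFun (hc₀ : 0 < c₀) : ContinuousOn (regFun b c₀ c₁) (Ici 0) :=
  fun _ ht => (hasDerivAt_regFun hc₀ ht).continuousAt.continuousWithinAt

theorem antitoneOn_regFun (hb : 0 < b) (hc₀ : 0 < c₀) (hc₁ : 0 < c₁) :
    AntitoneOn (regFun b c₀ c₁) (Ici 0) := by
  intro s hs t ht hst
  have hs : 0 ≤ s := hs
  refine mul_le_mul_of_nonneg_left ?_ hc₁.le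
  exact Real.rpow_le_rpow_of_nonpos (by linarith) (by linarith) (by linarith)

theorem tendsto_regFun_atTop (hb : 0 < b) : Tendsto (regFun b c₀ c₁) atTop (𝓝 0) := by
  have h := ((tendsto_rpow_neg_atTop hb).comp
    (tendsto_atTop_add_const_left atTop c₀ tendsto_id)).const_mul c₁
  rw [mul_zero] at h
  exact h

/-- Because `b < 1`, `(c₀ + t) ε(t)` is nondecreasing. This is what lets the shrinking barrier
outlast the motion of the path. -/
theorem logDeriv_regFun_mul_le (hb : 0 < b) (hb₁ : b < 1) (hc₀ : 0 < c₀) (hc₁ : 0 < c₁) {t : ℝ}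
    (ht : 0 ≤ t) : b / (c₀ + t) * regFun b c₀ c₁ 0 ≤ b / c₀ * regFun b c₀ c₁ t := by
  have hpos : 0 < c₀ + t := by linarith
  have h₁ : c₀ ^ (1 - b) ≤ (c₀ + t) ^ (1 - b) :=
    Real.rpow_le_rpow hc₀.le (by linarith) (by linarith)
  rw [sub_eq_add_neg, Real.rpow_add hc₀, Real.rpow_add hpos, Real.rpow_one, Real.rpow_one] at h₁
  simp only [regFun, add_zero]
  rw [div_mul_eq_mul_div, div_mul_eq_mul_div, div_le_div_iff₀ hpos hc₀]
  have h₂ := mul_le_mul_of_nonneg_left h₁ (mul_pos hb hc₁).le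
  linarith

end RegFun

/-! ### A priori bounds: residual decay and the tube around the path. -/

section APriori

variable {H : Type*} [NormedAddCommGroup H] [InnerProductSpace ℝ H]
  {F : H → H} {ε : ℝ → ℝ} {d u₀ y : H} {r M₁ M₂ b c₀ c₁ T : ℝ} {u : ℝ → H} {I : Set ℝ}

theorem regDeriv_add_const (F : H → H) (d : H) (e : ℝ) (u : H) :
    regDeriv (fun v => F v + d) e u = regDeriv F e u := by
  simp only [regDeriv, fderiv_add_const]

theorem field_add_const (F : H → H) (ε : ℝ → ℝ) (d : H) (t : ℝ) (u : H) :
    field (fun v => F v + d) ε t u = -(regDeriv F (ε t) u).inverse (F u + d + ε t • u) := by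
  rw [field, regDeriv_add_const]

theorem IsSolutionOn.mono {J : Set ℝ} (h : IsSolutionOn F ε u₀ I u) (hJ : J ⊆ I) :
    IsSolutionOn F ε u₀ J u :=
  ⟨h.1, fun t ht => ⟨(h.2 t (hJ ht)).1, (h.2 t (hJ ht)).2.1, (h.2 t (hJ ht)).2.2.mono hJ⟩⟩

theorem IsSolutionOn.continuousOn (h : IsSolutionOn F ε u₀ I u) : ContinuousOn u I :=
  fun t ht => (h.2 t ht).2.2.continuousWithinAt

/-- Along a solution the regularized residual `ψ` satisfies `ψ' = -ψ + ε' u`. -/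
theorem IsSolutionOn.hasDerivWithinAt_residual (h : IsSolutionOn F ε u₀ I u) {t ε' : ℝ}
    (ht : t ∈ I) (hε : HasDerivAt ε ε' t) :
    HasDerivWithinAt (fun s => F (u s) + ε s • u s) (-(F (u t) + ε t • u t) + ε' • u t) I t := by
  obtain ⟨h₁, h₂, h₃⟩ := h.2 t ht
  have h₄ := (h₁.hasFDerivAt.comp_hasDerivWithinAt t h₃).add (hε.hasDerivWithinAt.smul h₃)
  refine h₄.congr_deriv ?_
  have h₅ : regDeriv F (ε t) (u t) (field F ε t (u t)) = -(F (u t) + ε t • u t) := by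
    rw [field, map_neg, h₂.self_apply_inverse]
  rw [← h₅]
  simp only [regDeriv, add_apply, smul_apply, ContinuousLinearMap.id_apply]
  abel

theorem MonotoneOperator.norm_sub_regularizedZero_le (hF : MonotoneOperator F) {e : ℝ}
    (he : 0 < e) {v w : H} (hw : F w + e • w = 0) : ‖v - w‖ ≤ ‖F v + e • v‖ / e := by
  rw [le_div_iff₀ he]
  have h₁ : inner ℝ (F v + e • v) (v - w) = inner ℝ (F v - F w) (v - w) + e * ‖v - w‖ ^ 2 := by
    rw [← real_inner_self_eq_norm_sq, ← real_inner_smul_left, ← inner_add_left]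
    congr 1
    rw [← sub_zero (F v + e • v), ← hw]
    module
  have h₂ := hF v w
  have h₃ := real_inner_le_norm (F v + e • v) (v - w)
  rcases (norm_nonneg (v - w)).eq_or_lt with h | h
  · rw [← h, zero_mul]; positivity
  · nlinarith

/-- Decay of the regularized residual along a bounded solution. -/
theorem IsSolutionOn.norm_residual_le (hb : 0 < b) (hc₀ : 2 * b < c₀) (hc₁ : 0 < c₁)
    (h : IsSolutionOn F (regFun b c₀ c₁) u₀ (Icc 0 T) u) {C K : ℝ}
    (hC : ∀ t ∈ Icc 0 T, ‖u t‖ ≤ C) (hK : 4 * b * C * (c₀ + 4) ≤ K * c₀)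
    (hK₀ : ‖F u₀ + regFun b c₀ c₁ 0 • u₀‖ * (c₀ + 4) ≤ K * regFun b c₀ c₁ 0) {t : ℝ}
    (ht : t ∈ Icc 0 T) :
    ‖F (u t) + regFun b c₀ c₁ t • u t‖ ≤ K * regFun b c₀ c₁ t / (c₀ + 4 + t) := by
  have hc₀pos : 0 < c₀ := by linarith
  set ε := regFun b c₀ c₁ with hε
  set ψ : ℝ → H := fun s => F (u s) + ε s • u s with hψ
  have hC₀ : 0 ≤ C := (norm_nonneg _).trans (hC t ht)
  have hKnn : 0 ≤ K := by
    have : 0 ≤ 4 * b * C * (c₀ + 4) := by positivity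
    by_contra! hneg
    nlinarith
  have hd : ∀ s ∈ Icc 0 T, HasDerivWithinAt (fun s => Real.exp s • ψ s)
      (Real.exp s • (-(b / (c₀ + s) * ε s)) • u s) (Icc 0 T) s := by
    intro s hs
    have h₁ := (Real.hasDerivAt_exp s).hasDerivWithinAt.smul
      (h.hasDerivWithinAt_residual hs (hasDerivAt_regFun (b := b) (c₁ := c₁) hc₀pos hs.1))
    refine h₁.congr_deriv ?_
    module
  have hB : ∀ s ∈ Icc 0 T, HasDerivAt (fun s => Real.exp s * (K * ε s / (c₀ + 4 + s)))
      (Real.exp s * (K * ε s / (c₀ + 4 + s)) * (1 - b / (c₀ + s) - 1 / (c₀ + 4 + s))) s := by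
    intro s hs
    have hpos : 0 < c₀ + 4 + s := by linarith [hs.1]
    have h₁ := (Real.hasDerivAt_exp s).mul
      (((hasDerivAt_regFun (b := b) (c₁ := c₁) hc₀pos hs.1).const_mul K).div
        ((hasDerivAt_id s).const_add (c₀ + 4)) hpos.ne')
    refine h₁.congr_deriv ?_
    simp only [Pi.div_apply, id, ← hε]
    field_simp
    ring
  -- The factor `exp s` removes the term `-ψ`. The barrier's relative growth is `1 - b/(c₀+s) -
  -- 1/(c₀+4+s) ≥ 1/4`; the shift by `4` bounds the last term by `1/4`, and `hK` lets the remaining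
  -- quarter absorb the forcing `ε'u`.
  have key := image_norm_le_of_norm_deriv_right_le_deriv_boundary'
    (fun s hs => (hd s hs).continuousWithinAt)
    (fun s hs => (hd s (Ico_subset_Icc_self hs)).mono_of_mem_nhdsWithin (Icc_mem_nhdsGE_of_mem hs))
    (B := fun s => Real.exp s * (K * ε s / (c₀ + 4 + s))) (by
      rw [norm_smul, Real.norm_of_nonneg (Real.exp_pos _).le]
      gcongr
      rw [add_zero, le_div_iff₀ (by linarith)]
      simpa [hψ, h.1] using hK₀)
    (fun s hs => (hB s hs).continuousAt.continuousWithinAt)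
    (fun s hs => (hB s (Ico_subset_Icc_self hs)).hasDerivWithinAt)
    (fun s hs => by
      have hεs : 0 < ε s := regFun_pos hc₀pos hc₁ hs.1
      have hs₀ : 0 < c₀ + s := by linarith [hs.1]
      have hs₄ : 0 < c₀ + 4 + s := by linarith [hs.1]
      have h₁ : b / (c₀ + s) ≤ 1 / 2 := by
        rw [div_le_div_iff₀ hs₀ two_pos]; linarith [hs.1]
      have h₂ : 1 / (c₀ + 4 + s) ≤ 1 / 4 := by
        rw [div_le_div_iff₀ hs₄ (by norm_num)]; linarith [hs.1]
      have h₃ : 4 * (b / (c₀ + s)) * C ≤ K / (c₀ + 4 + s) := by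
        rw [le_div_iff₀ hs₄, mul_div_assoc', div_mul_eq_mul_div, div_mul_eq_mul_div,
          div_le_iff₀ hs₀]
        have : 4 * b * C ≤ K := by
          have : 0 ≤ 4 * b * C := by positivity
          nlinarith
        nlinarith [hs.1]
      have h₄ : 0 ≤ K / (c₀ + 4 + s) := by positivity
      rw [norm_smul, norm_smul, Real.norm_of_nonneg (Real.exp_pos _).le, norm_neg,
        Real.norm_of_nonneg (by positivity)]
      have h₅ : Real.exp s * (K * ε s / (c₀ + 4 + s)) * (1 - b / (c₀ + s) - 1 / (c₀ + 4 + s)) =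
          Real.exp s * (ε s * (K / (c₀ + 4 + s) * (1 - b / (c₀ + s) - 1 / (c₀ + 4 + s)))) := by
        ring
      have h₆ : Real.exp s * (b / (c₀ + s) * ε s * ‖u s‖) =
          Real.exp s * (ε s * (b / (c₀ + s) * ‖u s‖)) := by ring
      rw [h₅, h₆]
      refine mul_le_mul_of_nonneg_left (mul_le_mul_of_nonneg_left ?_ hεs.le) (Real.exp_pos _).le
      have h₇ : b / (c₀ + s) * ‖u s‖ ≤ b / (c₀ + s) * C := by
        gcongr
        exact hC s (Ico_subset_Icc_self hs)
      have h₈ : K / (c₀ + 4 + s) * (1 / 4) ≤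
          K / (c₀ + 4 + s) * (1 - b / (c₀ + s) - 1 / (c₀ + 4 + s)) := by
        gcongr
        linarith
      linarith) ht
  rw [norm_smul, Real.norm_of_nonneg (Real.exp_pos _).le] at key
  exact le_of_mul_le_mul_left key (Real.exp_pos _)

/-- The Newton field points towards the regularized zero, up to quadratic and noise terms. -/
theorem BoundedDerivatives.inner_field_le [CompleteSpace H] {R : ℝ}
    (h : BoundedDerivatives F u₀ R M₁ M₂) (hF : MonotoneOperator F) {t : ℝ} {v w : H}
    (hv : v ∈ Metric.closedBall u₀ R) (hwm : w ∈ Metric.closedBall u₀ R) (he : 0 < ε t)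
    (hw : F w + ε t • w = 0) :
    inner ℝ (field (fun v => F v + d) ε t v) (v - w) ≤
      -‖v - w‖ ^ 2 + (M₂ / 2 * ‖v - w‖ ^ 2 + ‖d‖) / ε t * ‖v - w‖ := by
  have hd := (h v hv).1
  set ρ := F w - F v - fderiv ℝ F v (w - v) with hρ
  -- Expanding at `v`, evaluating at `w` and subtracting the equation for `w` makes the linear part
  -- exactly `regDeriv` applied to `v - w`, which the inverse cancels.
  have h₁ : F v + d + ε t • v = regDeriv F (ε t) v (v - w) + (d - ρ) := by
    rw [← sub_zero (F v + d + ε t • v), ← hw, hρ, ← neg_sub v w]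
    simp only [regDeriv, add_apply, smul_apply, ContinuousLinearMap.id_apply, map_neg]
    module
  rw [field_add_const, h₁, map_add, (hF.isInvertible_regDeriv hd he).inverse_apply_self, neg_add,
    inner_add_left, inner_neg_left, real_inner_self_eq_norm_sq]
  gcongr
  refine (real_inner_le_norm _ _).trans ?_
  gcongr
  rw [norm_neg]
  refine (hF.norm_inverse_regDeriv_le hd he _).trans ?_
  gcongr
  have h₂ := h.norm_taylor_le hv hwm
  rw [norm_sub_rev w v] at h₂
  have h₃ := _root_.norm_sub_le d ρ
  linarith

theorem HasDerivWithinAt.norm_of_ne_zero {v : ℝ → H} {v' : H} {s : Set ℝ} {x : ℝ}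
    (hv : HasDerivWithinAt v v' s x) (hx : v x ≠ 0) :
    HasDerivWithinAt (fun z => ‖v z‖) (inner ℝ v' (v x) / ‖v x‖) s x := by
  have hn : 0 < ‖v x‖ := norm_pos_iff.2 hx
  have h := hv.norm_sq.sqrt (by positivity)
  simp only [Real.sqrt_sq (norm_nonneg _)] at h
  refine h.congr_deriv ?_
  rw [real_inner_comm]
  field_simp

/-- A curve that follows the (perturbed) Newton flow as long as it is in the ball stays close to
the path of regularized zeros. -/
theorem BoundedDerivatives.norm_sub_path_le [CompleteSpace H]
    (h : BoundedDerivatives F u₀ (3 * r) M₁ M₂) (hr : r = ‖y‖ + ‖u₀‖) (hF : MonotoneOperator F)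
    (hy : F y = 0) (hb : 0 < b) (hb₁ : b < 1) (hc₀ : 2 * b < c₀) (hc₁ : 0 < c₁) (hM₂ : 0 < M₂)
    (hε₀ : regFun b c₀ c₁ 0 = 4 * M₂ * r) {w : ℝ → H}
    (hw : ∀ e, 0 < e → F (w e) + e • w e = 0)
    (hd : ∀ t ∈ Icc 0 T, 8 * M₂ * ‖d‖ < 3 * (1 - 2 * (b / c₀)) * regFun b c₀ c₁ t ^ 2)
    (hu₀ : u 0 = u₀) (huc : ContinuousOn u (Icc 0 T))
    (hu : ∀ t ∈ Ico 0 T, u t ∈ Metric.closedBall u₀ (3 * r) →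
      HasDerivWithinAt u (field (fun v => F v + d) (regFun b c₀ c₁) t (u t)) (Icc 0 T) t) :
    ∀ t ∈ Icc 0 T, ‖u t - w (regFun b c₀ c₁ t)‖ ≤ regFun b c₀ c₁ t / (2 * M₂) := by
  have hc₀pos : 0 < c₀ := by linarith
  set ε := regFun b c₀ c₁ with hε
  have hpos : ∀ t, 0 ≤ t → 0 < ε t := fun t ht => regFun_pos hc₀pos hc₁ ht
  have hwle : ∀ e, 0 < e → ‖w e‖ ≤ ‖y‖ := fun e he =>
    hF.norm_regularizedZero_le_norm_zero he (hw e he) hy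
  have hyr : ‖y‖ ≤ r := by linarith [norm_nonneg u₀]
  have hlip : ∀ s t, 0 ≤ s → 0 ≤ t → ‖w (ε t) - w (ε s)‖ ≤ ‖y‖ * |ε t - ε s| / ε t := by
    intro s t hs ht
    refine (hF.norm_regularizedZero_sub_le (hpos t ht) (hw _ (hpos t ht))
      (hw _ (hpos s hs))).trans ?_
    have := hpos t ht
    rw [mul_comm]
    gcongr
    exact hwle _ (hpos s hs)
  have hεc : ContinuousOn ε (Icc 0 T) :=
    (continuousOn_regFun hc₀pos).mono Icc_subset_Ici_self
  have hwc : ContinuousOn (fun t => w (ε t)) (Icc 0 T) := by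
    intro t ht
    rw [ContinuousWithinAt, tendsto_iff_norm_sub_tendsto_zero]
    have h₁ : Tendsto (fun s => ‖y‖ * |ε t - ε s| / ε t) (𝓝[Icc 0 T] t) (𝓝 0) := by
      have h₂ : ContinuousWithinAt (fun s => ‖y‖ * |ε t - ε s| / ε t) (Icc 0 T) t :=
        ((continuousWithinAt_const.mul
          (continuousWithinAt_const.sub (hεc t ht)).abs)).div_const _
      simpa [ContinuousWithinAt] using h₂
    refine squeeze_zero' (Eventually.of_forall fun s => norm_nonneg _) ?_ h₁
    filter_upwards [self_mem_nhdsWithin] with s hs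
    rw [norm_sub_rev]
    exact hlip s t hs.1 ht.1
  refine le_barrier_of_majorant (f := fun t => ‖u t - w (ε t)‖) (β := fun t => ε t / (2 * M₂))
    (β' := fun t => -(b / (c₀ + t) * ε t) / (2 * M₂)) (huc.sub hwc).norm (hεc.div_const _) ?_ ?_ ?_
  · show ‖u 0 - w (ε 0)‖ ≤ ε 0 / (2 * M₂)
    have h₁ := _root_.norm_sub_le u₀ (w (ε 0))
    have h₂ := hwle _ (hpos 0 le_rfl)
    have h₃ : ε 0 / (2 * M₂) = 2 * r := by rw [hε₀]; field_simp; ring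
    rw [h₃, hu₀]
    linarith [norm_nonneg y, norm_nonneg u₀]
  · intro t ht
    exact ((hasDerivAt_regFun hc₀pos ht.1).div_const _).hasDerivWithinAt
  · intro x hx hcontact
    have hx₀ : 0 ≤ x := hx.1
    have he := hpos x hx₀
    set w₁ := w (ε x) with hw₁
    set k := ‖u x - w₁‖ with hk
    have hk₁ : k = ε x / (2 * M₂) := hcontact
    have hkpos : 0 < k := by rw [hk₁]; positivity
    have hw₁m : w₁ ∈ Metric.closedBall u₀ r := mem_closedBall_of_norm_le hr (hwle _ he)
    have hum : u x ∈ Metric.closedBall u₀ (3 * r) := by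
      have h₁ : ε x ≤ ε 0 := antitoneOn_regFun hb hc₀pos hc₁ self_mem_Ici hx₀ hx₀
      have h₂ : k ≤ 2 * r := by
        rw [hk₁, div_le_iff₀ (by positivity)]
        linarith
      rw [mem_closedBall_iff_norm] at hw₁m ⊢
      have h₃ : u x - u₀ = (u x - w₁) + (w₁ - u₀) := by abel
      rw [h₃]
      have := norm_add_le (u x - w₁) (w₁ - u₀)
      linarith
    set v := field (fun v => F v + d) ε x (u x) with hv
    -- The path is only known to be Lipschitz, so it is frozen at `w₁`; the added term bounds its
    -- later displacement and is differentiable.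
    have hmder : HasDerivWithinAt (fun z => ‖u z - w₁‖ + ‖y‖ * (ε x - ε z) / ε x)
        (inner ℝ v (u x - w₁) / k + ‖y‖ * (-(-(b / (c₀ + x) * ε x))) / ε x) (Icc x T) x := by
      have h₁ := ((hu x hx hum).mono (Icc_subset_Icc_left hx₀)).sub_const w₁
      have h₂ := HasDerivWithinAt.norm_of_ne_zero h₁ (norm_pos_iff.1 hkpos)
      exact h₂.add ((((hasDerivAt_regFun hc₀pos hx₀).const_sub (ε x)).const_mul ‖y‖).div_const
        (ε x)).hasDerivWithinAt
    refine ⟨_, _, ?_, ?_, hmder, ?_⟩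
    · simp [hk, hw₁]
    · intro z hz
      have hz₀ : 0 ≤ z := hx₀.trans hz.1.le
      have h₁ : ε z ≤ ε x := antitoneOn_regFun hb hc₀pos hc₁ hx₀ hz₀ hz.1.le
      have h₂ := hlip z x hz₀ hx₀
      rw [abs_of_nonneg (sub_nonneg.2 h₁)] at h₂
      show ‖u z - w (ε z)‖ ≤ _
      have h₃ : u z - w (ε z) = (u z - w₁) + (w₁ - w (ε z)) := by abel
      rw [h₃]
      exact (norm_add_le _ _).trans (by gcongr)
    · have h₁ := h.inner_field_le (d := d) hF hum (closedBall_subset_three hr hw₁m) he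
        (hw _ he)
      rw [← hv, ← hk] at h₁
      have h₂ : inner ℝ v (u x - w₁) / k ≤ -k + (M₂ / 2 * k ^ 2 + ‖d‖) / ε x := by
        rw [div_le_iff₀ hkpos]
        linarith
      set q := b / (c₀ + x) with hq
      have hq₀ : 0 < q := div_pos hb (by linarith)
      have hq₁ : q ≤ b / c₀ := div_le_div_of_nonneg_left hb.le hc₀pos (by linarith)
      have hq₂ := logDeriv_regFun_mul_le hb hb₁ hc₀pos hc₁ hx₀
      rw [← hε, ← hq, hε₀] at hq₂
      have hex : ε x = 2 * M₂ * k := by rw [hk₁]; field_simp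
      have hd₁ := hd x (Ico_subset_Icc_self hx)
      have h₃ : (M₂ / 2 * k ^ 2 + ‖d‖) / ε x = k / 4 + ‖d‖ / ε x := by
        rw [hex]; field_simp; ring
      -- The budget at contact: Newton contributes `-3k/4`, the path at most `(b/c₀)k/2`, and the
      -- barrier sinks at rate at most `(b/c₀)k`. The remainder `3/4 (1 - 2b/c₀) k` is left for the
      -- noise.
      have h₄ : ‖d‖ / ε x < 3 / 4 * (1 - 2 * (b / c₀)) * k := by
        rw [div_lt_iff₀ he]
        rw [hex] at hd₁ ⊢
        refine lt_of_mul_lt_mul_left (a := 8 * M₂) ?_ (by positivity)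
        refine hd₁.trans_eq ?_
        ring
      have h₅ : ‖y‖ * -(-(q * ε x)) / ε x = ‖y‖ * q := by field_simp
      have h₆ : -(q * ε x) / (2 * M₂) = -(q * k) := by rw [hex]; field_simp
      have h₇ : ‖y‖ * q ≤ b / c₀ * k / 2 := by
        have h₈ : q * r ≤ b / c₀ * k / 2 := by
          rw [hex] at hq₂
          refine le_of_mul_le_mul_left (a := 4 * M₂) ?_ (by positivity)
          linarith
        nlinarith
      have h₈ : q * k ≤ b / c₀ * k := by gcongr
      rw [h₅, h₆]
      rw [h₃] at h₂
      linarith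

/-- The source of the radius `3r`: since `ε(t) ≤ 4M₂r`, the tube has radius at most `2r`, and its
centre lies within `r` of `u₀`. -/
theorem BoundedDerivatives.mem_closedBall_of_norm_sub_path_le
    (hr : r = ‖y‖ + ‖u₀‖) (hF : MonotoneOperator F)
    (hy : F y = 0) (hb : 0 < b) (hc₀ : 0 < c₀) (hc₁ : 0 < c₁) (hM₂ : 0 < M₂)
    (hε₀ : regFun b c₀ c₁ 0 = 4 * M₂ * r) {w v : H} {t : ℝ} (ht : 0 ≤ t)
    (hw : F w + regFun b c₀ c₁ t • w = 0) (hv : ‖v - w‖ ≤ regFun b c₀ c₁ t / (2 * M₂)) :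
    v ∈ Metric.closedBall u₀ (3 * r) := by
  have h₁ : regFun b c₀ c₁ t ≤ regFun b c₀ c₁ 0 := antitoneOn_regFun hb hc₀ hc₁ self_mem_Ici ht ht
  have h₂ : ‖v - w‖ ≤ 2 * r := by
    refine hv.trans ?_
    rw [div_le_iff₀ (by positivity)]
    linarith
  have hwm := mem_closedBall_of_norm_le hr
    (hF.norm_regularizedZero_le_norm_zero (regFun_pos hc₀ hc₁ ht) hw hy)
  rw [mem_closedBall_iff_norm] at hwm ⊢
  have h₃ : v - u₀ = (v - w) + (w - u₀) := by abel
  rw [h₃]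
  have := norm_add_le (v - w) (w - u₀)
  linarith

end APriori

/-- There is a nonexpansive retraction of a Hilbert space onto a nonempty closed convex subset. -/
theorem exists_nonexpansive_retraction {H : Type*} [NormedAddCommGroup H] [InnerProductSpace ℝ H]
    [CompleteSpace H] {K : Set H} (hne : K.Nonempty) (hcl : IsClosed K) (hK : Convex ℝ K) :
    ∃ P : H → H, (∀ v, P v ∈ K) ∧ (∀ v ∈ K, P v = v) ∧ ∀ u v, ‖P u - P v‖ ≤ ‖u - v‖ := by
  have hex : ∀ v : H, ∃ p ∈ K, ∀ z ∈ K, inner ℝ (v - p) (z - p) ≤ 0 := fun v => by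
    obtain ⟨p, hp, hmin⟩ := exists_norm_eq_iInf_of_complete_convex hne hcl.isComplete hK v
    exact ⟨p, hp, (norm_eq_iInf_iff_real_inner_le_zero hK hp).1 hmin⟩
  choose P hP hPmin using hex
  refine ⟨P, hP, fun v hv => ?_, fun u v => ?_⟩
  · have h := hPmin v v hv
    rw [real_inner_self_eq_norm_sq] at h
    have : ‖v - P v‖ = 0 := by nlinarith [norm_nonneg (v - P v)]
    exact (sub_eq_zero.1 (norm_eq_zero.1 this)).symm
  · have h₁ := hPmin u (P v) (hP v)
    have h₂ := hPmin v (P u) (hP u)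
    -- The sum of the two variational inequalities: the projection is firmly nonexpansive.
    have h₃ : ‖P u - P v‖ ^ 2 ≤ inner ℝ (u - v) (P u - P v) := by
      rw [← neg_sub (P u) (P v), inner_neg_right] at h₁
      have h₄ : inner ℝ (u - v) (P u - P v) = inner ℝ (u - P u) (P u - P v) +
          inner ℝ (P u - P v) (P u - P v) - inner ℝ (v - P v) (P u - P v) := by
        rw [← inner_add_left, ← inner_sub_left]
        congr 1
        abel
      rw [h₄, real_inner_self_eq_norm_sq]
      linarith
    have h₄ := real_inner_le_norm (u - v) (P u - P v)
    rcases (norm_nonneg (P u - P v)).eq_or_lt with h | h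
    · rw [← h]; positivity
    · nlinarith

/-! ### Existence and uniqueness of the flow. -/

section Existence

variable {H : Type*} [NormedAddCommGroup H] [InnerProductSpace ℝ H]
  {F : H → H} {ε : ℝ → ℝ} {d u₀ y : H} {r M₁ M₂ b c₀ c₁ T : ℝ} {u : ℝ → H}

/-- The Newton field is bounded on the ball, Lipschitz in space and in the regularization
parameter, as long as that parameter stays in a compact subset of `(0, ∞)`. -/
theorem BoundedDerivatives.exists_field_bounds [CompleteSpace H] {R : ℝ} (h : BoundedDerivatives F u₀ R M₁ M₂)
    (hR : 0 ≤ R) (hF : MonotoneOperator F) (ε : ℝ → ℝ) (d : H) {m E : ℝ} (hm : 0 < m) :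
    ∃ L Q C : ℝ, 0 ≤ L ∧ 0 ≤ Q ∧ 0 ≤ C ∧ ∀ t s, ε t ∈ Icc m E → ε s ∈ Icc m E →
      ∀ v ∈ Metric.closedBall u₀ R, ∀ v' ∈ Metric.closedBall u₀ R,
        ‖field (fun v => F v + d) ε t v - field (fun v => F v + d) ε s v'‖ ≤
            L * ‖v - v'‖ + Q * |ε t - ε s| ∧
          ‖field (fun v => F v + d) ε t v‖ ≤ C := by
  have hu₀ := h u₀ (Metric.mem_closedBall_self hR)
  have hM₁ : 0 ≤ M₁ := (norm_nonneg _).trans hu₀.2.2.1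
  have hM₂ : 0 ≤ M₂ := (norm_nonneg (fderiv ℝ (fderiv ℝ F) u₀)).trans hu₀.2.2.2
  set N := ‖u₀‖ + R with hN
  set D := ‖F u₀‖ + M₁ * R + ‖d‖ + |E| * N with hD
  have hN₀ : 0 ≤ N := by positivity
  have hD₀ : 0 ≤ D := by positivity
  have hnorm : ∀ v ∈ Metric.closedBall u₀ R, ‖v‖ ≤ N := fun v hv => by
    rw [mem_closedBall_iff_norm] at hv
    have := norm_add_le (v - u₀) u₀
    rw [sub_add_cancel] at this
    linarith
  have hres : ∀ t, ε t ∈ Icc m E → ∀ v ∈ Metric.closedBall u₀ R, ‖F v + d + ε t • v‖ ≤ D := by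
    intro t ht v hv
    have h₁ := h.norm_sub_le hv (Metric.mem_closedBall_self hR)
    have h₂ := norm_add_le (F v - F u₀) (F u₀)
    rw [sub_add_cancel] at h₂
    have h₃ : M₁ * ‖v - u₀‖ ≤ M₁ * R := by
      gcongr
      exact mem_closedBall_iff_norm.1 hv
    have h₄ : ‖ε t • v‖ ≤ |E| * N := by
      rw [norm_smul, Real.norm_of_nonneg (hm.le.trans ht.1)]
      gcongr
      · exact ht.2.trans (le_abs_self E)
      · exact hnorm v hv
    have h₅ := norm_add_le (F v + d) (ε t • v)
    have h₆ := norm_add_le (F v) d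
    linarith
  refine ⟨(M₁ + |E| + M₂ * (D / m)) / m, (N + D / m) / m, D / m, by positivity, by positivity,
    by positivity, fun t s ht hs v hv v' hv' => ⟨?_, ?_⟩⟩
  · rw [field_add_const, field_add_const, ← neg_sub', norm_neg]
    have hεt : 0 < ε t := hm.trans_le ht.1
    have hεs : 0 < ε s := hm.trans_le hs.1
    refine (hF.norm_inverse_regDeriv_sub_le (h v hv).1 (h v' hv').1 hεt hεs _ _).trans ?_
    have h₁ : ‖(F v + d + ε t • v) - (F v' + d + ε s • v')‖ ≤
        M₁ * ‖v - v'‖ + |E| * ‖v - v'‖ + |ε t - ε s| * N := by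
      have h₂ : (F v + d + ε t • v) - (F v' + d + ε s • v') =
          (F v - F v') + ε t • (v - v') + (ε t - ε s) • v' := by module
      rw [h₂]
      refine (norm_add₃_le).trans ?_
      rw [norm_smul, norm_smul, Real.norm_of_nonneg hεt.le, Real.norm_eq_abs]
      gcongr
      · exact h.norm_sub_le hv hv'
      · exact ht.2.trans (le_abs_self E)
      · exact hnorm v' hv'
    have h₂ : ‖regDeriv F (ε t) v - regDeriv F (ε s) v'‖ ≤ M₂ * ‖v - v'‖ + |ε t - ε s| := by
      have h₃ : regDeriv F (ε t) v - regDeriv F (ε s) v' =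
          (fderiv ℝ F v - fderiv ℝ F v') + (ε t - ε s) • ContinuousLinearMap.id ℝ H := by
        simp only [regDeriv]
        module
      rw [h₃]
      refine (norm_add_le _ _).trans ?_
      gcongr
      · exact h.norm_fderiv_sub_le hv hv'
      · rw [norm_smul, Real.norm_eq_abs]
        exact mul_le_of_le_one_right (abs_nonneg _) ContinuousLinearMap.norm_id_le
    have h₃ : ‖F v' + d + ε s • v'‖ / ε s ≤ D / m :=
      div_le_div₀ hD₀ (hres s hs v' hv') hm hs.1
    calc _ ≤ (M₁ * ‖v - v'‖ + |E| * ‖v - v'‖ + |ε t - ε s| * N +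
          (M₂ * ‖v - v'‖ + |ε t - ε s|) * (D / m)) / m := by
          refine div_le_div₀ (by positivity) ?_ hm ht.1
          gcongr
      _ = _ := by ring
  · rw [field_add_const, norm_neg]
    exact (hF.norm_inverse_regDeriv_le (h v hv).1 (hm.trans_le ht.1) _).trans
      (div_le_div₀ hD₀ (hres t ht v hv) hm ht.1)

/-- The standing assumptions in the nondegenerate case `M₂ > 0`. -/
structure FlowAssumptions (F : H → H) (u₀ y : H) (r M₁ M₂ b c₀ c₁ : ℝ) : Prop where
  radius : r = ‖y‖ + ‖u₀‖
  mono : MonotoneOperator F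
  bdd : BoundedDerivatives F u₀ (3 * r) M₁ M₂
  minimal : IsMinimalNormZero F y
  b_pos : 0 < b
  b_lt_one : b < 1
  two_b_lt : 2 * b < c₀
  c₁_pos : 0 < c₁
  M₂_pos : 0 < M₂
  regFun_zero : regFun b c₀ c₁ 0 = 4 * M₂ * r

/-- The noise level is small compared with the regularization on `[0, T]`. -/
def NoiseSmall (d : H) (M₂ b c₀ c₁ T : ℝ) : Prop :=
  ∀ t ∈ Icc 0 T, 8 * M₂ * ‖d‖ < 3 * (1 - 2 * (b / c₀)) * regFun b c₀ c₁ t ^ 2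

namespace FlowAssumptions

theorem c₀_pos (h : FlowAssumptions F u₀ y r M₁ M₂ b c₀ c₁) : 0 < c₀ := by
  linarith [h.b_pos, h.two_b_lt]

theorem radius_nonneg (h : FlowAssumptions F u₀ y r M₁ M₂ b c₀ c₁) : 0 ≤ r := by
  rw [h.radius]; positivity

theorem noiseSmall_zero (h : FlowAssumptions F u₀ y r M₁ M₂ b c₀ c₁) (T : ℝ) :
    NoiseSmall (0 : H) M₂ b c₀ c₁ T := by
  intro t ht
  have h₁ := regFun_pos (b := b) h.c₀_pos h.c₁_pos ht.1
  have h₂ : b / c₀ < 1 / 2 := by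
    rw [div_lt_div_iff₀ h.c₀_pos two_pos]; linarith [h.two_b_lt]
  rw [norm_zero, mul_zero]
  have : 0 < 1 - 2 * (b / c₀) := by linarith
  positivity

variable [CompleteSpace H]

theorem exists_path (h : FlowAssumptions F u₀ y r M₁ M₂ b c₀ c₁) :
    ∃ w : ℝ → H, (∀ e, 0 < e → F (w e) + e • w e = 0) ∧ Tendsto w (𝓝[>] 0) (𝓝 y) := by
  have hex : ∀ e : ℝ, ∃ w : H, 0 < e → F w + e • w = 0 := fun e => by
    by_cases he : 0 < e
    · obtain ⟨w, hw⟩ := h.bdd.exists_regularizedZero h.radius h.mono h.minimal.1 he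
      exact ⟨w, fun _ => hw⟩
    · exact ⟨0, fun h => absurd h he⟩
  choose w hw using hex
  exact ⟨w, hw, h.bdd.tendsto_regularizedZero h.radius h.mono h.minimal hw⟩

/-- The equation is demanded only while `u t` is in the ball, so that the bound covers the projected
flow before it is known to solve the original equation. -/
theorem mem_closedBall_of_flow (h : FlowAssumptions F u₀ y r M₁ M₂ b c₀ c₁)
    (hd : NoiseSmall d M₂ b c₀ c₁ T) (hu₀ : u 0 = u₀) (huc : ContinuousOn u (Icc 0 T))
    (hu : ∀ t ∈ Ico 0 T, u t ∈ Metric.closedBall u₀ (3 * r) →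
      HasDerivWithinAt u (field (fun v => F v + d) (regFun b c₀ c₁) t (u t)) (Icc 0 T) t) :
    ∀ t ∈ Icc 0 T, u t ∈ Metric.closedBall u₀ (3 * r) := by
  obtain ⟨w, hw, -⟩ := h.exists_path
  intro t ht
  exact BoundedDerivatives.mem_closedBall_of_norm_sub_path_le h.radius h.mono h.minimal.1 h.b_pos
    h.c₀_pos h.c₁_pos h.M₂_pos h.regFun_zero ht.1 (hw _ (regFun_pos h.c₀_pos h.c₁_pos ht.1))
    (h.bdd.norm_sub_path_le h.radius h.mono h.minimal.1 h.b_pos h.b_lt_one h.two_b_lt h.c₁_pos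
      h.M₂_pos h.regFun_zero hw hd hu₀ huc hu t ht)

theorem mem_closedBall (h : FlowAssumptions F u₀ y r M₁ M₂ b c₀ c₁)
    (hd : NoiseSmall d M₂ b c₀ c₁ T)
    (hu : IsSolutionOn (fun v => F v + d) (regFun b c₀ c₁) u₀ (Icc 0 T) u) :
    ∀ t ∈ Icc 0 T, u t ∈ Metric.closedBall u₀ (3 * r) :=
  h.mem_closedBall_of_flow hd hu.1 hu.continuousOn fun t ht _ =>
    (hu.2 t (Ico_subset_Icc_self ht)).2.2

theorem exists_field_bounds (h : FlowAssumptions F u₀ y r M₁ M₂ b c₀ c₁) (d : H) (hT : 0 ≤ T) :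
    ∃ L Q C : ℝ, 0 ≤ L ∧ 0 ≤ Q ∧ 0 ≤ C ∧ ∀ t ∈ Icc 0 T, ∀ s ∈ Icc 0 T,
      ∀ v ∈ Metric.closedBall u₀ (3 * r), ∀ v' ∈ Metric.closedBall u₀ (3 * r),
        ‖field (fun v => F v + d) (regFun b c₀ c₁) t v -
            field (fun v => F v + d) (regFun b c₀ c₁) s v'‖ ≤
            L * ‖v - v'‖ + Q * |regFun b c₀ c₁ t - regFun b c₀ c₁ s| ∧
          ‖field (fun v => F v + d) (regFun b c₀ c₁) t v‖ ≤ C := by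
  have hr := h.radius_nonneg
  obtain ⟨L, Q, C, hL, hQ, hC, hbound⟩ := h.bdd.exists_field_bounds (by positivity) h.mono
    (regFun b c₀ c₁) d (regFun_pos (b := b) h.c₀_pos h.c₁_pos hT) (E := regFun b c₀ c₁ 0)
  have hanti := antitoneOn_regFun h.b_pos h.c₀_pos h.c₁_pos
  have hmem : ∀ t ∈ Icc 0 T, regFun b c₀ c₁ t ∈ Icc (regFun b c₀ c₁ T) (regFun b c₀ c₁ 0) :=
    fun t ht => ⟨hanti ht.1 hT ht.2, hanti self_mem_Ici ht.1 ht.1⟩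
  exact ⟨L, Q, C, hL, hQ, hC, fun t ht s hs => hbound t s (hmem t ht) (hmem s hs)⟩

/-- Composed with the retraction, the field is bounded and globally Lipschitz in space, so
Picard–Lindelöf covers all of `[0, T]`. The a priori bound then makes the retraction invisible along
the solution. -/
theorem exists_solution_Icc (h : FlowAssumptions F u₀ y r M₁ M₂ b c₀ c₁)
    (hd : NoiseSmall d M₂ b c₀ c₁ T) (hT : 0 ≤ T) :
    ∃ u, IsSolutionOn (fun v => F v + d) (regFun b c₀ c₁) u₀ (Icc 0 T) u := by
  have hr := h.radius_nonneg
  have hu₀ : u₀ ∈ Metric.closedBall u₀ (3 * r) := Metric.mem_closedBall_self (by positivity)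
  obtain ⟨L, Q, C, hL, hQ, hC, hbound⟩ := h.exists_field_bounds d hT
  obtain ⟨P, hP, hPid, hPlip⟩ := exists_nonexpansive_retraction ⟨u₀, hu₀⟩
    Metric.isClosed_closedBall (convex_closedBall u₀ (3 * r))
  set Φ := field (fun v => F v + d) (regFun b c₀ c₁) with hΦ
  have hpl : IsPicardLindelof (fun t v => Φ t (P v)) (⟨0, le_rfl, hT⟩ : Icc 0 T) u₀
      (Real.toNNReal (C * T)) 0 (Real.toNNReal C) (Real.toNNReal L) := by
    refine ⟨fun t ht => LipschitzOnWith.of_dist_le_mul fun v _ v' _ => ?_, fun v _ t ht => ?_,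
      fun t ht v _ => ?_, ?_⟩
    · rw [dist_eq_norm, dist_eq_norm, Real.coe_toNNReal _ hL]
      have h₁ := (hbound t ht t ht (P v) (hP v) (P v') (hP v')).1
      rw [sub_self, abs_zero, mul_zero, add_zero] at h₁
      exact h₁.trans (by gcongr; exact hPlip v v')
    · rw [ContinuousWithinAt, tendsto_iff_norm_sub_tendsto_zero]
      have hεc : ContinuousWithinAt (regFun b c₀ c₁) (Icc 0 T) t :=
        (continuousOn_regFun h.c₀_pos).mono Icc_subset_Ici_self t ht
      have h₁ : Tendsto (fun s => Q * |regFun b c₀ c₁ s - regFun b c₀ c₁ t|) (𝓝[Icc 0 T] t)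
          (𝓝 0) := by
        have h₂ : ContinuousWithinAt (fun s => Q * |regFun b c₀ c₁ s - regFun b c₀ c₁ t|)
            (Icc 0 T) t := continuousWithinAt_const.mul (hεc.sub continuousWithinAt_const).abs
        simpa [ContinuousWithinAt] using h₂
      refine squeeze_zero' (Eventually.of_forall fun s => norm_nonneg _) ?_ h₁
      filter_upwards [self_mem_nhdsWithin] with s hs
      simpa using (hbound s hs t ht (P v) (hP v) (P v) (hP v)).1
    · rw [Real.coe_toNNReal _ hC]
      exact (hbound t ht t ht (P v) (hP v) (P v) (hP v)).2
    · simp [hC, hT, mul_nonneg hC hT]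
  obtain ⟨u, hu0, hu⟩ := hpl.exists_eq_forall_mem_Icc_hasDerivWithinAt₀
  have hu0 : u 0 = u₀ := hu0
  have hball := h.mem_closedBall_of_flow hd hu0 (fun t ht => (hu t ht).continuousWithinAt)
    fun t ht hut => by
      have h₁ := hu t (Ico_subset_Icc_self ht)
      rwa [hPid _ hut] at h₁
  refine ⟨u, hu0, fun t ht => ⟨(h.bdd _ (hball t ht)).1.add_const d, ?_, ?_⟩⟩
  · rw [regDeriv_add_const]
    exact h.mono.isInvertible_regDeriv (h.bdd _ (hball t ht)).1
      (regFun_pos h.c₀_pos h.c₁_pos ht.1)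
  · have h₁ := hu t ht
    rwa [hPid _ (hball t ht)] at h₁

theorem solution_unique (h : FlowAssumptions F u₀ y r M₁ M₂ b c₀ c₁)
    (hd : NoiseSmall d M₂ b c₀ c₁ T) {v : ℝ → H}
    (hu : IsSolutionOn (fun v => F v + d) (regFun b c₀ c₁) u₀ (Icc 0 T) u)
    (hv : IsSolutionOn (fun v => F v + d) (regFun b c₀ c₁) u₀ (Icc 0 T) v) :
    EqOn u v (Icc 0 T) := by
  rcases le_or_gt 0 T with hT | hT
  · obtain ⟨L, Q, C, hL, hQ, hC, hbound⟩ := h.exists_field_bounds d hT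
    have hder : ∀ {x : ℝ → H}, IsSolutionOn (fun v => F v + d) (regFun b c₀ c₁) u₀ (Icc 0 T) x →
        ∀ t ∈ Ico 0 T, HasDerivWithinAt x (field (fun v => F v + d) (regFun b c₀ c₁) t (x t))
          (Ici t) t := fun hx t ht =>
      (hx.2 t (Ico_subset_Icc_self ht)).2.2.mono_of_mem_nhdsWithin (Icc_mem_nhdsGE_of_mem ht)
    refine ODE_solution_unique_of_mem_Icc_right (K := Real.toNNReal L)
      (s := fun _ => Metric.closedBall u₀ (3 * r))
      (fun t ht => LipschitzOnWith.of_dist_le_mul fun x hx x' hx' => ?_)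
      hu.continuousOn (hder hu) (fun t ht => h.mem_closedBall hd hu t (Ico_subset_Icc_self ht))
      hv.continuousOn (hder hv) (fun t ht => h.mem_closedBall hd hv t (Ico_subset_Icc_self ht))
      (hu.1.trans hv.1.symm)
    have ht := Ico_subset_Icc_self ht
    rw [dist_eq_norm, dist_eq_norm, Real.coe_toNNReal _ hL]
    simpa using (hbound t ht t ht x hx x' hx').1
  · simp [Icc_eq_empty_of_lt hT]

theorem exists_solution_Ici (h : FlowAssumptions F u₀ y r M₁ M₂ b c₀ c₁)
    (hd : ∀ T, NoiseSmall d M₂ b c₀ c₁ T) :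
    ∃ u, IsSolutionOn (fun v => F v + d) (regFun b c₀ c₁) u₀ (Ici 0) u := by
  have hex : ∀ T : ℝ, ∃ u, 0 ≤ T →
      IsSolutionOn (fun v => F v + d) (regFun b c₀ c₁) u₀ (Icc 0 T) u := fun T => by
    by_cases hT : 0 ≤ T
    · obtain ⟨u, hu⟩ := h.exists_solution_Icc (hd T) hT
      exact ⟨u, fun _ => hu⟩
    · exact ⟨fun _ => 0, fun h => absurd h hT⟩
  choose U hU using hex
  have hagree : ∀ {s S T : ℝ}, 0 ≤ s → s ≤ S → s ≤ T → U S s = U T s := by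
    intro s S T hs hS hT
    exact h.solution_unique (hd s) ((hU S (hs.trans hS)).mono (Icc_subset_Icc_right hS))
      ((hU T (hs.trans hT)).mono (Icc_subset_Icc_right hT)) ⟨hs, le_rfl⟩
  -- The horizon `t + 1` leaves room to the right of `t`, so by uniqueness the glued function agrees
  -- with one fixed solution near `t`.
  refine ⟨fun t => U (t + 1) t, ?_, fun t ht => ?_⟩
  · exact (hU (0 + 1) (by norm_num)).1
  · have ht : 0 ≤ t := ht
    obtain ⟨h₁, h₂, h₃⟩ := (hU (t + 1) (by linarith)).2 t ⟨ht, by linarith⟩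
    refine ⟨h₁, h₂, ?_⟩
    have hnear : Iio (t + 1) ∈ 𝓝[Ici 0] t := mem_nhdsWithin_of_mem_nhds (Iio_mem_nhds (by linarith))
    have hmem : Icc 0 (t + 1) ∈ 𝓝[Ici 0] t := by
      filter_upwards [self_mem_nhdsWithin, hnear] with s hs hs'
      exact ⟨hs, le_of_lt hs'⟩
    refine (h₃.mono_of_mem_nhdsWithin hmem).congr_of_eventuallyEq ?_ rfl
    filter_upwards [hmem] with s hs
    exact hagree hs.1 (by linarith) hs.2

end FlowAssumptions

end Existence

/-! ### The stopping time. -/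

section StoppingTime

/-- The stopping time `δ^(-1/4)`. -/
noncomputable def stoppingTime (δ : ℝ) : ℝ := (√(√δ))⁻¹

theorem stoppingTime_nonneg (δ : ℝ) : 0 ≤ stoppingTime δ := by
  unfold stoppingTime; positivity

theorem tendsto_stoppingTime : Tendsto stoppingTime (𝓝[>] 0) atTop := by
  refine tendsto_inv_nhdsGT_zero.comp (tendsto_nhdsWithin_iff.2 ⟨?_, ?_⟩)
  · have h : ContinuousAt (fun δ : ℝ => √(√δ)) 0 := by fun_prop
    simpa [ContinuousAt] using h.tendsto.mono_left (nhdsWithin_le_nhds (s := Ioi 0))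
  · filter_upwards [self_mem_nhdsWithin] with δ hδ
    have hδ : 0 < δ := hδ
    exact Real.sqrt_pos.2 (Real.sqrt_pos.2 hδ)

variable {b c₀ c₁ : ℝ}

/-- As `b < 1`, eventually `ε(τ) ≥ c₁/(2τ)`; with `τ = δ^(-1/4)` the quotient is at most `4√δ/c₁²`.
The square is needed for `NoiseSmall`, and it also gives `δ/ε(τ) → 0`. -/
theorem tendsto_div_regFun_stoppingTime_sq (hb₁ : b < 1) (hc₀ : 0 < c₀)
    (hc₁ : 0 < c₁) :
    Tendsto (fun δ => δ / regFun b c₀ c₁ (stoppingTime δ) ^ 2) (𝓝[>] 0) (𝓝 0) := by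
  have hlim : Tendsto (fun δ : ℝ => 4 * √δ / c₁ ^ 2) (𝓝[>] 0) (𝓝 0) := by
    have h : ContinuousAt (fun δ : ℝ => 4 * √δ / c₁ ^ 2) 0 := by fun_prop
    simpa [ContinuousAt] using h.tendsto.mono_left (nhdsWithin_le_nhds (s := Ioi 0))
  refine squeeze_zero' ?_ ?_ hlim
  · filter_upwards [self_mem_nhdsWithin] with δ hδ
    have hδ : 0 < δ := hδ
    positivity
  · filter_upwards [self_mem_nhdsWithin, tendsto_stoppingTime.eventually_ge_atTop (max c₀ 1)]
      with δ hδ hτ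
    have hδ : 0 < δ := hδ
    set τ := stoppingTime δ with hτdef
    have hτ₀ : c₀ ≤ τ := (le_max_left _ _).trans hτ
    have hτ₁ : 1 ≤ τ := (le_max_right _ _).trans hτ
    have hsq : δ * τ ^ 2 = √δ := by
      rw [hτdef, stoppingTime, inv_pow, Real.sq_sqrt (Real.sqrt_nonneg _)]
      have h₁ := Real.mul_self_sqrt hδ.le
      have h₂ := Real.sqrt_pos.2 hδ
      field_simp
      linarith
    have hbase : c₁ / (2 * τ) ≤ regFun b c₀ c₁ τ := by
      rw [regFun, div_eq_mul_inv]
      gcongr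
      calc (2 * τ)⁻¹ ≤ (c₀ + τ)⁻¹ := by gcongr; linarith
        _ = (c₀ + τ) ^ (-1 : ℝ) := (Real.rpow_neg_one _).symm
        _ ≤ (c₀ + τ) ^ (-b) := Real.rpow_le_rpow_of_exponent_le (by linarith) (by linarith)
    calc δ / regFun b c₀ c₁ τ ^ 2 ≤ δ / (c₁ / (2 * τ)) ^ 2 := by gcongr
      _ = 4 * (δ * τ ^ 2) / c₁ ^ 2 := by field_simp; ring
      _ = 4 * √δ / c₁ ^ 2 := by rw [hsq]

end StoppingTime

/-! ### Convergence for exact and noisy data. -/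

section Convergence

variable {H : Type*} [NormedAddCommGroup H] [InnerProductSpace ℝ H] [CompleteSpace H]
  {F : H → H} {d u₀ y : H} {r M₁ M₂ b c₀ c₁ T : ℝ} {u : ℝ → H}

theorem tendsto_regFun_nhdsGT (hb : 0 < b) (hc₀ : 0 < c₀) (hc₁ : 0 < c₁) :
    Tendsto (regFun b c₀ c₁) atTop (𝓝[>] 0) := by
  refine tendsto_nhdsWithin_iff.2 ⟨tendsto_regFun_atTop hb, ?_⟩
  filter_upwards [eventually_ge_atTop 0] with t ht
  exact regFun_pos hc₀ hc₁ ht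

namespace FlowAssumptions

/-- Distance of a solution to the path of regularized zeros, uniformly in the noise. -/
theorem exists_norm_sub_path_le (h : FlowAssumptions F u₀ y r M₁ M₂ b c₀ c₁) :
    ∃ K : ℝ, ∀ T, 0 ≤ T → ∀ d : H, ‖d‖ ≤ 1 → NoiseSmall d M₂ b c₀ c₁ T → ∀ u : ℝ → H,
      IsSolutionOn (fun v => F v + d) (regFun b c₀ c₁) u₀ (Icc 0 T) u → ∀ w : H,
        F w + regFun b c₀ c₁ T • w = 0 →
          ‖u T - w‖ ≤ K / (c₀ + 4 + T) + ‖d‖ / regFun b c₀ c₁ T := by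
  have hr := h.radius_nonneg
  have hc₀ := h.c₀_pos
  have hb := h.b_pos
  have hε₀ := regFun_pos (b := b) hc₀ h.c₁_pos le_rfl
  set C := ‖u₀‖ + 3 * r with hC
  set N := ‖F u₀‖ + 1 + regFun b c₀ c₁ 0 * ‖u₀‖ with hN
  -- `K₁` absorbs the forcing and `K₂` the initial residual; the `1` in `N` bounds `‖d‖`, which
  -- makes `K₁ + K₂` independent of the noise.
  set K₁ := 4 * b * C * (c₀ + 4) / c₀ with hK₁
  set K₂ := N * (c₀ + 4) / regFun b c₀ c₁ 0 with hK₂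
  have hK₁nn : 0 ≤ K₁ := by positivity
  have hK₂nn : 0 ≤ K₂ := by positivity
  refine ⟨K₁ + K₂, fun T hT d hd hnoise u hu w hw => ?_⟩
  have hT' : T ∈ Icc 0 T := ⟨hT, le_rfl⟩
  have hε := regFun_pos (b := b) hc₀ h.c₁_pos hT
  have hball := h.mem_closedBall hnoise hu
  have hres := hu.norm_residual_le hb h.two_b_lt h.c₁_pos (C := C) (K := K₁ + K₂)
    (fun t ht => by
      have h₁ := mem_closedBall_iff_norm.1 (hball t ht)
      have h₂ := norm_add_le (u t - u₀) u₀
      rw [sub_add_cancel] at h₂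
      linarith)
    (by
      have h₁ : K₁ * c₀ = 4 * b * C * (c₀ + 4) := by rw [hK₁]; field_simp
      have h₂ : 0 ≤ K₂ * c₀ := by positivity
      linarith)
    (by
      have h₁ : K₂ * regFun b c₀ c₁ 0 = N * (c₀ + 4) := by rw [hK₂]; field_simp
      have h₂ : 0 ≤ K₁ * regFun b c₀ c₁ 0 := by positivity
      have h₃ : ‖F u₀ + d + regFun b c₀ c₁ 0 • u₀‖ ≤ N := by
        refine norm_add₃_le.trans ?_
        rw [norm_smul, Real.norm_of_nonneg hε₀.le]
        linarith
      have h₄ : ‖F u₀ + d + regFun b c₀ c₁ 0 • u₀‖ * (c₀ + 4) ≤ N * (c₀ + 4) := by gcongr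
      linarith) hT'
  refine (h.mono.norm_sub_regularizedZero_le hε hw).trans ?_
  have h₁ : F (u T) + regFun b c₀ c₁ T • u T =
      (F (u T) + d + regFun b c₀ c₁ T • u T) - d := by abel
  have h₂ := norm_sub_le (F (u T) + d + regFun b c₀ c₁ T • u T) d
  rw [h₁, div_le_iff₀ hε, add_mul, div_mul_cancel₀ _ hε.ne', div_mul_eq_mul_div]
  linarith

theorem solution_tendsto (h : FlowAssumptions F u₀ y r M₁ M₂ b c₀ c₁)
    (hu : IsSolutionOn F (regFun b c₀ c₁) u₀ (Ici 0) u) : Tendsto u atTop (𝓝 y) := by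
  obtain ⟨w, hw, hwy⟩ := h.exists_path
  obtain ⟨K, hK⟩ := h.exists_norm_sub_path_le
  have hwt := hwy.comp (tendsto_regFun_nhdsGT h.b_pos h.c₀_pos h.c₁_pos)
  have hlim : Tendsto (fun t : ℝ => K / (c₀ + 4 + t)) atTop (𝓝 0) :=
    (tendsto_atTop_add_const_left atTop (c₀ + 4) tendsto_id).const_div_atTop K
  have hdiff : Tendsto (fun t => u t - w (regFun b c₀ c₁ t)) atTop (𝓝 0) := by
    refine squeeze_zero_norm' ?_ hlim
    filter_upwards [eventually_ge_atTop 0] with t ht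
    have := hK t ht 0 (by simp) (h.noiseSmall_zero t) u
      (by simpa using hu.mono Icc_subset_Ici_self) _ (hw _ (regFun_pos h.c₀_pos h.c₁_pos ht))
    simpa using this
  simpa using hdiff.add hwt

theorem solution_mem_closedBall (h : FlowAssumptions F u₀ y r M₁ M₂ b c₀ c₁)
    (hu : IsSolutionOn F (regFun b c₀ c₁) u₀ (Ici 0) u) {t : ℝ} (ht : 0 ≤ t) :
    u t ∈ Metric.closedBall u₀ (3 * r) :=
  h.mem_closedBall (h.noiseSmall_zero t) (by simpa using hu.mono Icc_subset_Ici_self) t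
    ⟨ht, le_rfl⟩

/-- Convergence at the stopping time, uniformly over the noise of norm at most `δ`. -/
theorem noisy_convergence (h : FlowAssumptions F u₀ y r M₁ M₂ b c₀ c₁) {η : ℝ} (hη : 0 < η) :
    ∀ᶠ δ in 𝓝[>] 0, ∀ d : H, ‖d‖ ≤ δ →
      (∃ u, IsSolutionOn (fun v => F v + d) (regFun b c₀ c₁) u₀ (Icc 0 (stoppingTime δ)) u) ∧
      ∀ u, IsSolutionOn (fun v => F v + d) (regFun b c₀ c₁) u₀ (Icc 0 (stoppingTime δ)) u →
        ‖u (stoppingTime δ) - y‖ < η := by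
  obtain ⟨w, hw, hwy⟩ := h.exists_path
  obtain ⟨K, hK⟩ := h.exists_norm_sub_path_le
  have hM₂ := h.M₂_pos
  have hc₀ := h.c₀_pos
  have hετ := (tendsto_regFun_nhdsGT h.b_pos hc₀ h.c₁_pos).comp tendsto_stoppingTime
  have hratio := tendsto_div_regFun_stoppingTime_sq h.b_lt_one hc₀ h.c₁_pos
  have hslack : 0 < 1 - 2 * (b / c₀) := by
    have : b / c₀ < 1 / 2 := by
      rw [div_lt_div_iff₀ hc₀ two_pos]; linarith [h.two_b_lt]
    linarith
  have hlim : Tendsto (fun δ => K / (c₀ + 4 + stoppingTime δ) +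
      δ / regFun b c₀ c₁ (stoppingTime δ) + ‖w (regFun b c₀ c₁ (stoppingTime δ)) - y‖)
      (𝓝[>] 0) (𝓝 0) := by
    have h₁ : Tendsto (fun δ => K / (c₀ + 4 + stoppingTime δ)) (𝓝[>] 0) (𝓝 0) :=
      (tendsto_atTop_add_const_left _ (c₀ + 4) tendsto_stoppingTime).const_div_atTop K
    have h₂ : Tendsto (fun δ => δ / regFun b c₀ c₁ (stoppingTime δ)) (𝓝[>] 0) (𝓝 0) := by
      have h₃ := hratio.mul (tendsto_nhdsWithin_iff.1 hετ).1
      rw [zero_mul] at h₃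
      refine h₃.congr fun δ => ?_
      have := regFun_pos (b := b) hc₀ h.c₁_pos (stoppingTime_nonneg δ)
      simp only [Function.comp_apply]
      field_simp
    have h₃ := tendsto_iff_norm_sub_tendsto_zero.1 (hwy.comp hετ)
    simpa using (h₁.add h₂).add h₃
  filter_upwards [self_mem_nhdsWithin, Ioo_mem_nhdsGT one_pos, hlim.eventually (gt_mem_nhds hη),
    hratio.eventually (gt_mem_nhds (show 0 < 3 * (1 - 2 * (b / c₀)) / (8 * M₂) by positivity))]
    with δ hδ hδ₁ hδη hδκ d hd
  set τ := stoppingTime δ with hτ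
  have hτ₀ : 0 ≤ τ := stoppingTime_nonneg δ
  have hε := regFun_pos (b := b) hc₀ h.c₁_pos hτ₀
  have hnoise : NoiseSmall d M₂ b c₀ c₁ τ := by
    intro t ht
    have h₁ : regFun b c₀ c₁ τ ≤ regFun b c₀ c₁ t :=
      antitoneOn_regFun h.b_pos hc₀ h.c₁_pos ht.1 hτ₀ ht.2
    rw [div_lt_div_iff₀ (by positivity) (by positivity)] at hδκ
    calc 8 * M₂ * ‖d‖ ≤ δ * (8 * M₂) := by rw [mul_comm]; gcongr
      _ < 3 * (1 - 2 * (b / c₀)) * regFun b c₀ c₁ τ ^ 2 := hδκ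
      _ ≤ 3 * (1 - 2 * (b / c₀)) * regFun b c₀ c₁ t ^ 2 := by gcongr
  refine ⟨h.exists_solution_Icc hnoise hτ₀, fun u hu => ?_⟩
  have h₁ := hK τ hτ₀ d (hd.trans hδ₁.2.le) hnoise u hu _ (hw _ hε)
  have h₂ : ‖d‖ / regFun b c₀ c₁ τ ≤ δ / regFun b c₀ c₁ τ := by gcongr
  have h₃ := norm_add_le (u τ - w (regFun b c₀ c₁ τ)) (w (regFun b c₀ c₁ τ) - y)
  rw [sub_add_sub_cancel] at h₃
  linarith

end FlowAssumptions

end Convergence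

/-! ### The degenerate case `r = 0`. -/

section ZeroRadius

variable {H : Type*} [NormedAddCommGroup H] [InnerProductSpace ℝ H] {F : H → H} {b c₀ c₁ : ℝ}

theorem isSolutionOn_zero [CompleteSpace H] (hF : MonotoneOperator F) (h₀ : F 0 = 0)
    (hd : DifferentiableAt ℝ F 0) (hc₀ : 0 < c₀) (hc₁ : 0 < c₁) :
    IsSolutionOn F (regFun b c₀ c₁) 0 (Ici 0) fun _ => 0 := by
  refine ⟨rfl, fun t ht => ⟨hd, hF.isInvertible_regDeriv hd (regFun_pos hc₀ hc₁ ht), ?_⟩⟩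
  have h : field F (regFun b c₀ c₁) t 0 = 0 := by simp [field, h₀]
  rw [h]
  exact hasDerivWithinAt_const _ _ _

/-- No tube is available here. Instead `0` is the regularized zero for every `ε`, so `ε‖u‖ ≤ ‖ψ‖`
and hence `‖ψ'‖ ≤ (1 + b/c₀)‖ψ‖`; Grönwall with `ψ(0) = 0` forces `ψ = 0`. -/
theorem IsSolutionOn.eq_zero (hF : MonotoneOperator F) (h₀ : F 0 = 0) (hb : 0 < b)
    (hc₀ : 0 < c₀) (hc₁ : 0 < c₁) {u : ℝ → H}
    (hu : IsSolutionOn F (regFun b c₀ c₁) 0 (Ici 0) u) {t : ℝ} (ht : 0 ≤ t) : u t = 0 := by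
  have hle : ∀ s, 0 ≤ s →
      ‖u s‖ ≤ ‖F (u s) + regFun b c₀ c₁ s • u s‖ / regFun b c₀ c₁ s := fun s hs => by
    simpa using hF.norm_sub_regularizedZero_le (regFun_pos hc₀ hc₁ hs) (v := u s) (w := 0)
      (by simp [h₀])
  have hder : ∀ s, 0 ≤ s → HasDerivWithinAt (fun s => F (u s) + regFun b c₀ c₁ s • u s)
      (-(F (u s) + regFun b c₀ c₁ s • u s) + (-(b / (c₀ + s) * regFun b c₀ c₁ s)) • u s)
      (Ici 0) s := fun s hs => hu.hasDerivWithinAt_residual hs (hasDerivAt_regFun hc₀ hs)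
  have hzero := eq_zero_of_abs_deriv_le_mul_abs_self_of_eq_zero_right (a := 0) (b := t)
    (K := 1 + b / c₀)
    (fun s hs => (hder s hs.1).continuousWithinAt.mono Icc_subset_Ici_self)
    (fun s hs => (hder s hs.1).mono (Ici_subset_Ici.2 hs.1)) (by simp [hu.1, h₀])
    (fun s hs => by
      have hs₀ : 0 ≤ s := hs.1
      have hε := regFun_pos (b := b) hc₀ hc₁ hs₀
      have h₁ := hle s hs₀
      rw [le_div_iff₀ hε] at h₁
      refine (norm_add_le _ _).trans ?_
      rw [norm_neg, norm_smul, norm_neg, Real.norm_of_nonneg (by positivity), add_mul, one_mul]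
      refine add_le_add le_rfl ?_
      calc b / (c₀ + s) * regFun b c₀ c₁ s * ‖u s‖
          = b / (c₀ + s) * (‖u s‖ * regFun b c₀ c₁ s) := by ring
        _ ≤ b / c₀ * ‖F (u s) + regFun b c₀ c₁ s • u s‖ := by
            gcongr
            linarith) t ⟨ht, le_rfl⟩
  have := hle t ht
  rw [hzero, norm_zero, zero_div] at this
  exact norm_le_zero_iff.1 this

/-- On a one-point interval every vector is a derivative, so the constant function solves the
problem for any noise. -/
theorem isSolutionOn_const_Icc_self [CompleteSpace H] (hF : MonotoneOperator F) {u₀ : H}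
    (hd : DifferentiableAt ℝ F u₀) (hc₀ : 0 < c₀) (hc₁ : 0 < c₁) :
    IsSolutionOn F (regFun b c₀ c₁) u₀ (Icc 0 0) fun _ => u₀ := by
  refine ⟨rfl, fun t ht =>
    ⟨hd, hF.isInvertible_regDeriv hd (regFun_pos hc₀ hc₁ ht.1), ?_⟩⟩
  rw [Icc_self]
  exact HasFDerivWithinAt.singleton

end ZeroRadius

theorem MonotoneOperator.add_const {H : Type*} [NormedAddCommGroup H] [InnerProductSpace ℝ H]
    {F : H → H} (hF : MonotoneOperator F) (d : H) : MonotoneOperator fun v => F v + d :=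
  fun u v => by simpa using hF u v

end NewtonFlow

/-! ### Assembly of the two cases. -/

theorem theorem4p2 {H : Type*} [NormedAddCommGroup H] [InnerProductSpace ℝ H] [CompleteSpace H]
    (B : H → H) (f u₀ y : H) (F : H → H) (hF : ∀ u, F u = B u - f)
    (r M₁ M₂ : ℝ) (hr : r = ‖y‖ + ‖u₀‖)
    (hmono : NewtonFlow.MonotoneOperator F)
    (hbdd : NewtonFlow.BoundedDerivatives F u₀ (3 * r) M₁ M₂)
    (hy : NewtonFlow.IsMinimalNormZero F y)
    (b c₀ c₁ : ℝ) (hb₀ : 0 < b) (hb₁ : b < 1) (hc₀ : 2 * b < c₀) (hc₁ : 0 < c₁)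
    (hε₀ : 0 < r → NewtonFlow.regFun b c₀ c₁ 0 = 4 * M₂ * r) :
    -- the minimal-norm zero is unique
    (∀ z : H, NewtonFlow.IsMinimalNormZero F z → z = y) ∧
    -- exact data: a global solution exists, stays in the ball and converges to `y`
    (∃ u : ℝ → H, NewtonFlow.IsSolutionOn F (NewtonFlow.regFun b c₀ c₁) u₀ (Ici 0) u) ∧
    (∀ u : ℝ → H, NewtonFlow.IsSolutionOn F (NewtonFlow.regFun b c₀ c₁) u₀ (Ici 0) u →
      (∀ t : ℝ, 0 ≤ t → u t ∈ Metric.closedBall u₀ (3 * r)) ∧ Tendsto u atTop (𝓝 y)) ∧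
    -- noisy data: a stopping time depending on `δ` but not on the particular noisy datum
    (∃ τ : ℝ → ℝ, (∀ δ : ℝ, 0 < δ → 0 ≤ τ δ) ∧
      ∀ η : ℝ, 0 < η → ∃ δ₀ : ℝ, 0 < δ₀ ∧ ∀ δ : ℝ, 0 < δ → δ < δ₀ →
        ∀ fδ : H, ‖fδ - f‖ ≤ δ →
          (∃ u : ℝ → H, NewtonFlow.IsSolutionOn (fun v => B v - fδ)
            (NewtonFlow.regFun b c₀ c₁) u₀ (Icc 0 (τ δ)) u) ∧
          (∀ u : ℝ → H, NewtonFlow.IsSolutionOn (fun v => B v - fδ)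
            (NewtonFlow.regFun b c₀ c₁) u₀ (Icc 0 (τ δ)) u → ‖u (τ δ) - y‖ < η)) := by
  have hc₀pos : 0 < c₀ := by linarith
  have hnoisy : ∀ fδ : H, (fun v => B v - fδ) = fun v => F v + (f - fδ) := fun fδ => by
    funext v
    rw [hF]
    abel
  refine ⟨fun z hz => hbdd.minimalNormZero_unique hr hmono hy hz, ?_⟩
  have hr₀ : 0 ≤ r := by rw [hr]; positivity
  rcases hr₀.eq_or_lt with hr0 | hrpos
  · obtain rfl : y = 0 := norm_eq_zero.1 (by linarith [norm_nonneg y, norm_nonneg u₀])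
    obtain rfl : u₀ = 0 := norm_eq_zero.1 (by linarith [norm_nonneg (0 : H), norm_nonneg u₀])
    have hmem : (0 : H) ∈ Metric.closedBall (0 : H) (3 * r) :=
      Metric.mem_closedBall_self (by positivity)
    have hd := (hbdd 0 hmem).1
    have hzero : ∀ u : ℝ → H,
        NewtonFlow.IsSolutionOn F (NewtonFlow.regFun b c₀ c₁) 0 (Ici 0) u →
          ∀ t, 0 ≤ t → u t = 0 := fun u hu t ht =>
      hu.eq_zero hmono hy.1 hb₀ hc₀pos hc₁ ht
    -- Stopping at time `0` suffices: the initial value already equals `y`.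
    refine ⟨⟨_, NewtonFlow.isSolutionOn_zero hmono hy.1 hd hc₀pos hc₁⟩, fun u hu => ⟨fun t ht => ?_,
      tendsto_const_nhds.congr' ?_⟩, fun _ => 0, fun _ _ => le_rfl, fun η hη => ⟨1, one_pos,
      fun δ hδ _ fδ hfδ => ⟨⟨fun _ => 0, ?_⟩, fun u hu => ?_⟩⟩⟩
    · rw [hzero u hu t ht]
      exact hmem
    · filter_upwards [eventually_ge_atTop 0] with t ht
      exact (hzero u hu t ht).symm
    · rw [hnoisy]
      exact NewtonFlow.isSolutionOn_const_Icc_self (hmono.add_const _) (hd.add_const _) hc₀pos hc₁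
    · simpa [hu.1] using hη
  · have hε := hε₀ hrpos
    -- Positivity of `ε(0) = 4M₂r` forces it.
    have hM₂ : 0 < M₂ := by
      have h₁ := NewtonFlow.regFun_pos (b := b) hc₀pos hc₁ le_rfl
      rw [hε] at h₁
      by_contra! hM₂
      nlinarith
    have h : NewtonFlow.FlowAssumptions F u₀ y r M₁ M₂ b c₀ c₁ :=
      ⟨hr, hmono, hbdd, hy, hb₀, hb₁, hc₀, hc₁, hM₂, hε⟩
    refine ⟨by simpa using h.exists_solution_Ici h.noiseSmall_zero,
      fun u hu => ⟨fun t ht => h.solution_mem_closedBall hu ht, h.solution_tendsto hu⟩,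
      NewtonFlow.stoppingTime, fun δ _ => NewtonFlow.stoppingTime_nonneg δ, fun η hη => ?_⟩
    obtain ⟨δ₀, hδ₀, hsub⟩ := mem_nhdsGT_iff_exists_Ioo_subset.1 (h.noisy_convergence hη)
    refine ⟨δ₀, hδ₀, fun δ hδ hδ' fδ hfδ => ?_⟩
    rw [hnoisy]
    exact hsub ⟨hδ, hδ'⟩ (f - fδ) (by rwa [norm_sub_rev])
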